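/- **Conventions.** Composition is in diagrammatic order. A *restriction category* is a category with an operation assigning to each $f:A\to B$ a map $\overline f:A\to A$ such that $\overline f f=f$, $\overline g\,\overline f=\overline f\,\overline g$, $\overline{\overline g f}=\overline g\,\overline f$ and $f\overline h=\overline{fh}\,f$. Write $f\le g$ if $\overline f g=f$, $f\smile g$ if $\overline f g=\overline g f$, and call $f$ total if $\overline f=1$. A *join restriction category* is a restriction category in which every finite (possibly empty) set of pairwise compatible ($\smile$) parallel maps has a join for $\le$, and $h(\bigvee_i f_i)=\bigvee_i hf_i$; $\emptyset$ is the empty join. A *cartesian restriction category* has an object $T$ with, for each $A$, a unique total map $!_A:A\to T$, such that $!_T=1_T$ and $f\,!_B\le\, !_A$ for all $f:A\to B$, and chosen products $A\times B$ with total projections $\pi_0,\pi_1$ such that for $f:Z\to A$, $g:Z\to B$ there is a unique $\langle f,g\rangle:Z\to A\times B$ with $\langle f,g\rangle\pi_0=\overline{\langle f,g\rangle}f$, $\langle f,g\rangle\pi_1=\overline{\langle f,g\rangle}g$, $\overline{\langle f,g\rangle}=\overline f\,\overline g$. Put $f\times g=\langle\pi_0f,\pi_1g\rangle$ and $\Delta=\langle1,1\rangle$.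 A *left additive restriction category* has commutative monoid structures on its hom-sets with $\overline{f+g}=\overline f\,\overline g$, $\overline0=1$, $f(g+h)=fg+fh$, $f0=\overline f0$. A map $f$ is *additive* if $(x+y)f\smile xf+yf$ and $0f\smile0$ for all $x,y$. A *cartesian left additive restriction category* is both, with $(f+g)\times(h+k)=(f\times h)+(g\times k)$, $0=0\times0$, and $\pi_0,\pi_1,\Delta$ additive. A *differential restriction category* is one of these with an operation taking $f:A\to B$ to $D[f]:A\times A\to B$ such that 1. $D[f+g]=D[f]+D[g]$, $D[0]=0$; 2. $\langle g+h,k\rangle D[f]=\langle g,k\rangle D[f]+\langle h,k\rangle D[f]$, $\langle0,g\rangle D[f]=\overline{gf}\,0$; 3. $D[\pi_0]=\pi_0\pi_0$, $D[\pi_1]=\pi_0\pi_1$; 4. $D[\langle f,g\rangle]=\langle D[f],D[g]\rangle$; 5. $D[fg]=\langle D[f],\pi_1f\rangle D[g]$; 6. $\langle\langle g,0\rangle,\langle h,k\rangle\rangle D[D[f]]=\overline h\langle g,k\rangle D[f]$; 7. $\langle\langle0,h\rangle,\langle g,k\rangle\rangle D[D[f]]=\langle\langle0,g\rangle,\langle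 h,k\rangle\rangle D[D[f]]$; 8. $D[\overline f]=(1\times\overline f)\pi_0$; 9. $\overline{D[f]}=1\times\overline f$. A *differential join restriction category* is a differential restriction category that is also a join restriction category. **Classical maps.** Let $\mathbb X$ be a join restriction category. A *classical piece* $A\to B$ is a pair $(f,f')$ of maps $A\to B$ with $f'\le f$; pieces $(f,f')$, $(g,g')$ are *disjoint* if $\overline f\,\overline g=\overline{f'}\,\overline g\vee\overline f\,\overline{g'}$. A *raw classical map* $\bigsqcup_i(f_i,f_i')$ is a finite set of pairwise disjoint classical pieces. A *classical map* is a class of raw classical maps for the equivalence relation generated by replacing one piece at a time by the rules *breaking*, $(f,f')\equiv(ef,ef')\sqcup(f,f'\vee ef)$ for $e=\overline e$, and *collapse*, $(f,f)\equiv\emptyset$. **Theorem.** Let $\mathbb X$ be a differential join restriction category. Then the following operations on classical maps are well defined (the right-hand sides are raw classical maps, whose classes do not depend on the representatives): $$\bigsqcup_i(f_i,f_i')\,\bigsqcup_j(g_j,g_j')=\bigsqcup_{i,j}(f_ig_j,\;f_i'g_j\vee f_ig_j'),\qquad \overline{\bigsqcup_i(f_i,f_i')}=\bigsqcup_i(\overline{f_i},\overline{f_i'}),$$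 $$\Big\langle\bigsqcup_i(f_i,f_i'),\bigsqcup_j(g_j,g_j')\Big\rangle=\bigsqcup_{i,j}(\langle f_i,g_j\rangle,\;\langle f_i',g_j\rangle\vee\langle f_i,g_j'\rangle),$$ $$\bigsqcup_i(f_i,f_i')+\bigsqcup_j(g_j,g_j')=\bigsqcup_{i,j}(f_i+g_j,\;(f_i'+g_j)\vee(f_i+g_j')),\qquad D\Big[\bigsqcup_i(f_i,f_i')\Big]=\bigsqcup_i(D[f_i],D[f_i']).$$ With these operations, the objects, the terminal object and the product objects of $\mathbb X$, identities $(1,\emptyset)$, terminal maps $(!,\emptyset)$, projections $(\pi_0,\emptyset)$, $(\pi_1,\emptyset)$ and zero maps $(0,\emptyset)$, the classical maps form a differential join restriction category $\mathbf{Cl}(\mathbb X)$. -/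

import Mathlib

open CategoryTheory

universe v u

/-! Composition is written in diagrammatic order: `f ≫ g` is `f` followed by `g`. -/

namespace DiffRestr

/-! ### The operations -/

/-- A restriction operator `f ↦ f̄`. -/
class RestrictionOp (C : Type u) [Category.{v} C] where
  rest : ∀ {A B : C}, (A ⟶ B) → (A ⟶ A)

/-- A chosen object `T` with maps `!`, and chosen products with projections and pairings. -/
class ProductOp (C : Type u) [Category.{v} C] where
  T : C
  bang : ∀ A : C, A ⟶ T
  prod : C → C → C
  π₀ : ∀ A B : C, prod A B ⟶ A
  π₁ : ∀ A B : C, prod A B ⟶ B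
  pair : ∀ {Z A B : C}, (Z ⟶ A) → (Z ⟶ B) → (Z ⟶ prod A B)

/-- Addition and zero on every hom-set. -/
class AdditiveOp (C : Type u) [Category.{v} C] where
  add : ∀ {A B : C}, (A ⟶ B) → (A ⟶ B) → (A ⟶ B)
  zero : ∀ A B : C, A ⟶ B

/-- A differentiation operation. -/
class DifferentialOp (C : Type u) [Category.{v} C] [ProductOp C] where
  D : ∀ {A B : C}, (A ⟶ B) → (ProductOp.prod A A ⟶ B)

open RestrictionOp ProductOp AdditiveOp DifferentialOp

section Basic

variable {C : Type u} [Category.{v} C]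

/-- The restriction order: `f ≤ g` iff `f̄ g = f`. -/
def Le [RestrictionOp C] {A B : C} (f g : A ⟶ B) : Prop := rest f ≫ g = f

/-- Compatibility `f ⌣ g`: `f̄ g = ḡ f`. -/
def Compat [RestrictionOp C] {A B : C} (f g : A ⟶ B) : Prop := rest f ≫ g = rest g ≫ f

/-- `f` is total: `f̄ = 1`. -/
def Total [RestrictionOp C] {A B : C} (f : A ⟶ B) : Prop := rest f = 𝟙 A

/-- `j` is the join (least upper bound) of the set `s` of maps in the restriction order. -/
def IsJoin [RestrictionOp C] {A B : C} (s : Set (A ⟶ B)) (j : A ⟶ B) : Prop :=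
  (∀ f ∈ s, Le f j) ∧ ∀ g : A ⟶ B, (∀ f ∈ s, Le f g) → Le j g

/-- `f × g = ⟨π₀ f, π₁ g⟩`. -/
def prodMap [ProductOp C] {A B A' B' : C} (f : A ⟶ A') (g : B ⟶ B') :
    prod A B ⟶ prod A' B' :=
  pair (π₀ A B ≫ f) (π₁ A B ≫ g)

/-- The diagonal `Δ = ⟨1, 1⟩`. -/
def diag [ProductOp C] (A : C) : A ⟶ prod A A := pair (𝟙 A) (𝟙 A)

/-- `f` is additive: `(x + y) f ⌣ x f + y f` and `0 f ⌣ 0`. -/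
def IsAdditive [RestrictionOp C] [AdditiveOp C] {A B : C} (f : A ⟶ B) : Prop :=
  (∀ (Z : C) (x y : Z ⟶ A), Compat (add x y ≫ f) (add (x ≫ f) (y ≫ f))) ∧
    ∀ Z : C, Compat (zero Z A ≫ f) (zero Z B)

end Basic

/-! ### The laws -/

/-- Restriction categories. -/
class RestrictionCategory (C : Type u) [Category.{v} C] [RestrictionOp C] : Prop where
  R1 : ∀ {A B : C} (f : A ⟶ B), rest f ≫ f = f
  R2 : ∀ {A B B' : C} (f : A ⟶ B) (g : A ⟶ B'), rest g ≫ rest f = rest f ≫ rest g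
  R3 : ∀ {A B B' : C} (f : A ⟶ B) (g : A ⟶ B'), rest (rest g ≫ f) = rest g ≫ rest f
  R4 : ∀ {A B B' : C} (f : A ⟶ B) (h : B ⟶ B'), f ≫ rest h = rest (f ≫ h) ≫ f

/-- Join restriction categories: every finite set of pairwise compatible maps (the empty set
included) has a join, and joins are preserved by composition on the left. -/
class JoinRestrictionCategory (C : Type u) [Category.{v} C] [RestrictionOp C] : Prop
    extends RestrictionCategory C where
  exists_join : ∀ {A B : C} (s : Set (A ⟶ B)), s.Finite →
    (∀ f ∈ s, ∀ g ∈ s, Compat f g) →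
    ∃ j : A ⟶ B, IsJoin s j ∧ ∀ {Z : C} (h : Z ⟶ A), IsJoin ((fun f => h ≫ f) '' s) (h ≫ j)

/-- Cartesian restriction categories: a restriction terminal object and restriction products. -/
class CartesianRestrictionCategory (C : Type u) [Category.{v} C] [RestrictionOp C]
    [ProductOp C] : Prop extends RestrictionCategory C where
  bang_total : ∀ A : C, Total (bang A)
  bang_unique : ∀ {A : C} (f : A ⟶ T), Total f → f = bang A
  bang_T : bang (T : C) = 𝟙 T
  comp_bang : ∀ {A B : C} (f : A ⟶ B), Le (f ≫ bang B) (bang A)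
  π₀_total : ∀ A B : C, Total (π₀ A B)
  π₁_total : ∀ A B : C, Total (π₁ A B)
  pair_π₀ : ∀ {Z A B : C} (f : Z ⟶ A) (g : Z ⟶ B), pair f g ≫ π₀ A B = rest (pair f g) ≫ f
  pair_π₁ : ∀ {Z A B : C} (f : Z ⟶ A) (g : Z ⟶ B), pair f g ≫ π₁ A B = rest (pair f g) ≫ g
  rest_pair : ∀ {Z A B : C} (f : Z ⟶ A) (g : Z ⟶ B), rest (pair f g) = rest f ≫ rest g
  pair_unique : ∀ {Z A B : C} (f : Z ⟶ A) (g : Z ⟶ B) (h : Z ⟶ prod A B),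
    h ≫ π₀ A B = rest h ≫ f → h ≫ π₁ A B = rest h ≫ g → rest h = rest f ≫ rest g →
    h = pair f g

/-- Left additive restriction categories. -/
class LeftAdditiveRestrictionCategory (C : Type u) [Category.{v} C] [RestrictionOp C]
    [AdditiveOp C] : Prop extends RestrictionCategory C where
  add_assoc : ∀ {A B : C} (f g h : A ⟶ B), add (add f g) h = add f (add g h)
  add_comm : ∀ {A B : C} (f g : A ⟶ B), add f g = add g f
  zero_add : ∀ {A B : C} (f : A ⟶ B), add (zero A B) f = f
  rest_add : ∀ {A B : C} (f g : A ⟶ B), rest (add f g) = rest f ≫ rest g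
  rest_zero : ∀ A B : C, rest (zero A B) = 𝟙 A
  comp_add : ∀ {Z A B : C} (f : Z ⟶ A) (g h : A ⟶ B), f ≫ add g h = add (f ≫ g) (f ≫ h)
  comp_zero : ∀ {Z A : C} (f : Z ⟶ A) (B : C), f ≫ zero A B = rest f ≫ zero Z B

/-- Cartesian left additive restriction categories. -/
class CartesianLeftAdditiveRestrictionCategory (C : Type u) [Category.{v} C] [RestrictionOp C]
    [ProductOp C] [AdditiveOp C] : Prop
    extends CartesianRestrictionCategory C, LeftAdditiveRestrictionCategory C where
  prodMap_add : ∀ {A B A' B' : C} (f g : A ⟶ A') (h k : B ⟶ B'),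
    prodMap (add f g) (add h k) = add (prodMap f h) (prodMap g k)
  prodMap_zero : ∀ A B A' B' : C,
    zero (prod A B) (prod A' B') = prodMap (zero A A') (zero B B')
  π₀_additive : ∀ A B : C, IsAdditive (π₀ A B)
  π₁_additive : ∀ A B : C, IsAdditive (π₁ A B)
  diag_additive : ∀ A : C, IsAdditive (diag A)

/-- Differential restriction categories. -/
class DifferentialRestrictionCategory (C : Type u) [Category.{v} C] [RestrictionOp C]
    [ProductOp C] [AdditiveOp C] [DifferentialOp C] : Prop
    extends CartesianLeftAdditiveRestrictionCategory C where
  DR1_add : ∀ {A B : C} (f g : A ⟶ B), D (add f g) = add (D f) (D g)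
  DR1_zero : ∀ A B : C, D (zero A B) = zero (prod A A) B
  DR2_add : ∀ {Z A B : C} (f : A ⟶ B) (g h k : Z ⟶ A),
    pair (add g h) k ≫ D f = add (pair g k ≫ D f) (pair h k ≫ D f)
  DR2_zero : ∀ {Z A B : C} (f : A ⟶ B) (g : Z ⟶ A),
    pair (zero Z A) g ≫ D f = rest (g ≫ f) ≫ zero Z B
  DR3_π₀ : ∀ A B : C, D (π₀ A B) = π₀ (prod A B) (prod A B) ≫ π₀ A B
  DR3_π₁ : ∀ A B : C, D (π₁ A B) = π₀ (prod A B) (prod A B) ≫ π₁ A B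
  DR4 : ∀ {Z A B : C} (f : Z ⟶ A) (g : Z ⟶ B), D (pair f g) = pair (D f) (D g)
  DR5 : ∀ {A B B' : C} (f : A ⟶ B) (g : B ⟶ B'),
    D (f ≫ g) = pair (D f) (π₁ A A ≫ f) ≫ D g
  DR6 : ∀ {Z A B : C} (f : A ⟶ B) (g h k : Z ⟶ A),
    pair (pair g (zero Z A)) (pair h k) ≫ D (D f) = rest h ≫ pair g k ≫ D f
  DR7 : ∀ {Z A B : C} (f : A ⟶ B) (g h k : Z ⟶ A),
    pair (pair (zero Z A) h) (pair g k) ≫ D (D f) =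
      pair (pair (zero Z A) g) (pair h k) ≫ D (D f)
  DR8 : ∀ {A B : C} (f : A ⟶ B), D (rest f) = prodMap (𝟙 A) (rest f) ≫ π₀ A A
  DR9 : ∀ {A B : C} (f : A ⟶ B), rest (D f) = prodMap (𝟙 A) (rest f)

/-- Differential join restriction categories. -/
class DifferentialJoinRestrictionCategory (C : Type u) [Category.{v} C] [RestrictionOp C]
    [ProductOp C] [AdditiveOp C] [DifferentialOp C] : Prop
    extends DifferentialRestrictionCategory C, JoinRestrictionCategory C

/-! ### Basic facts needed to form classical pieces -/

section Facts

variable {C : Type u} [Category.{v} C] [RestrictionOp C]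

section

variable [RestrictionCategory C]

theorem rest_id (A : C) : rest (𝟙 A) = 𝟙 A := by
  simpa using RestrictionCategory.R1 (𝟙 A)

theorem rest_rest {A B : C} (f : A ⟶ B) : rest (rest f) = rest f := by
  have h := RestrictionCategory.R3 (𝟙 A) f
  rwa [rest_id, Category.comp_id] at h

theorem rest_comp_rest {A B B' : C} (f : A ⟶ B) (g : B ⟶ B') :
    rest (f ≫ rest g) = rest (f ≫ g) := by
  have h := RestrictionCategory.R3 (f ≫ g) f
  rw [← Category.assoc, RestrictionCategory.R1] at h
  rw [RestrictionCategory.R4, RestrictionCategory.R3, RestrictionCategory.R2, ← h]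

theorem le_self {A B : C} (f : A ⟶ B) : Le f f := RestrictionCategory.R1 f

theorem le_rest_comp {A B B' : C} (e : A ⟶ B') (f : A ⟶ B) : Le (rest e ≫ f) f := by
  unfold Le
  rw [RestrictionCategory.R3, Category.assoc, RestrictionCategory.R1]

theorem compat_of_le {A B : C} {f g h : A ⟶ B} (hf : Le f h) (hg : Le g h) : Compat f g := by
  unfold Le at hf hg
  unfold Compat
  calc rest f ≫ g = rest f ≫ rest g ≫ h := by rw [hg]
    _ = rest g ≫ rest f ≫ h := by
      rw [← Category.assoc, ← Category.assoc, RestrictionCategory.R2]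
    _ = rest g ≫ f := by rw [hf]

theorem comp_le_comp {A B B' : C} {f f' : A ⟶ B} {g g' : B ⟶ B'} (hf : Le f' f)
    (hg : Le g' g) : Le (f' ≫ g') (f ≫ g) := by
  have e : f' ≫ g' = rest (f' ≫ g') ≫ f ≫ g := by
    calc f' ≫ g' = f' ≫ rest g' ≫ g := by rw [hg]
      _ = rest (f' ≫ g') ≫ f' ≫ g := by
        rw [← Category.assoc, RestrictionCategory.R4, Category.assoc]
      _ = rest (f' ≫ g') ≫ rest f' ≫ f ≫ g := by
        rw [← Category.assoc (rest f') f g, hf]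
      _ = rest (f' ≫ g') ≫ f ≫ g := by
        rw [← Category.assoc, RestrictionCategory.R2, ← RestrictionCategory.R3,
          ← Category.assoc (rest f') f' g', RestrictionCategory.R1]
  exact e.symm

theorem rest_le_rest {A B : C} {f f' : A ⟶ B} (hf : Le f' f) : Le (rest f') (rest f) := by
  unfold Le at hf ⊢
  rw [rest_rest, ← RestrictionCategory.R3, hf]

end

section

variable [JoinRestrictionCategory C]

/-- The join `f ∨ g` of two compatible maps. -/
noncomputable def join {A B : C} (f g : A ⟶ B) (h : Compat f g) : A ⟶ B :=
  (JoinRestrictionCategory.exists_join {f, g} (Set.toFinite _) (by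
    rintro a (rfl | rfl) b (rfl | rfl)
    exacts [rfl, h, h.symm, rfl])).choose

/-- The nowhere defined map `∅`, the join of the empty family. -/
noncomputable def empty (A B : C) : A ⟶ B :=
  (JoinRestrictionCategory.exists_join (∅ : Set (A ⟶ B)) (Set.toFinite _)
    (fun _ h => h.elim)).choose

theorem join_isJoin {A B : C} (f g : A ⟶ B) (h : Compat f g) :
    IsJoin {f, g} (join f g h) :=
  (JoinRestrictionCategory.exists_join {f, g} (Set.toFinite _) (by
    rintro a (rfl | rfl) b (rfl | rfl)
    exacts [rfl, h, h.symm, rfl])).choose_spec.1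

theorem join_le {A B : C} {f g k : A ⟶ B} (h : Compat f g) (hf : Le f k) (hg : Le g k) :
    Le (join f g h) k := by
  refine (join_isJoin f g h).2 k ?_
  rintro a (rfl | rfl)
  exacts [hf, hg]

theorem empty_le {A B : C} (f : A ⟶ B) : Le (empty A B) f :=
  (JoinRestrictionCategory.exists_join (∅ : Set (A ⟶ B)) (Set.toFinite _)
    (fun _ h => h.elim)).choose_spec.1.2 f (fun _ h => h.elim)

end

section

variable [ProductOp C] [CartesianRestrictionCategory C]

theorem comp_pair {W Z A B : C} (k : W ⟶ Z) (f : Z ⟶ A) (g : Z ⟶ B) :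
    k ≫ pair f g = pair (k ≫ f) (k ≫ g) := by
  have r : rest (k ≫ pair f g) = rest (k ≫ f) ≫ rest (k ≫ g) := by
    rw [← rest_comp_rest k (pair f g), CartesianRestrictionCategory.rest_pair, ← Category.assoc,
      RestrictionCategory.R4 k f, Category.assoc, RestrictionCategory.R3, rest_comp_rest]
  have aux : k ≫ rest (pair f g) = rest (k ≫ pair f g) ≫ k := RestrictionCategory.R4 _ _
  refine CartesianRestrictionCategory.pair_unique _ _ _ ?_ ?_ r
  · rw [Category.assoc, CartesianRestrictionCategory.pair_π₀, ← Category.assoc, aux,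
      Category.assoc]
  · rw [Category.assoc, CartesianRestrictionCategory.pair_π₁, ← Category.assoc, aux,
      Category.assoc]

theorem pair_le_pair {Z A B : C} {f f' : Z ⟶ A} {g g' : Z ⟶ B} (hf : Le f' f)
    (hg : Le g' g) : Le (pair f' g') (pair f g) := by
  unfold Le at hf hg ⊢
  have r : rest (rest (pair f' g') ≫ pair f g) = rest f' ≫ rest g' := by
    rw [RestrictionCategory.R3, CartesianRestrictionCategory.rest_pair,
      CartesianRestrictionCategory.rest_pair]
    have hf' : rest f' ≫ rest f = rest f' := by rw [← RestrictionCategory.R3, hf]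
    have hg' : rest g' ≫ rest g = rest g' := by rw [← RestrictionCategory.R3, hg]
    rw [Category.assoc, ← Category.assoc (rest g'), RestrictionCategory.R2 f g',
      Category.assoc, ← Category.assoc, hf', hg']
  refine CartesianRestrictionCategory.pair_unique _ _ _ ?_ ?_ r
  · rw [r, Category.assoc, CartesianRestrictionCategory.pair_π₀, ← Category.assoc,
      ← RestrictionCategory.R3, r, RestrictionCategory.R2, Category.assoc, Category.assoc, hf,
      RestrictionCategory.R1]
  · rw [r, Category.assoc, CartesianRestrictionCategory.pair_π₁, ← Category.assoc,
      ← RestrictionCategory.R3, r, Category.assoc, Category.assoc, hg, RestrictionCategory.R1]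

end

section

variable [AdditiveOp C] [LeftAdditiveRestrictionCategory C]

theorem add_eq {A B : C} (f g : A ⟶ B) : add f g = add (rest g ≫ f) (rest f ≫ g) := by
  calc add f g = rest (add f g) ≫ add f g := (RestrictionCategory.R1 _).symm
    _ = add ((rest f ≫ rest g) ≫ f) ((rest f ≫ rest g) ≫ g) := by
      rw [LeftAdditiveRestrictionCategory.rest_add, LeftAdditiveRestrictionCategory.comp_add]
    _ = add (rest g ≫ f) (rest f ≫ g) := by
      congr 1
      · rw [RestrictionCategory.R2, Category.assoc, RestrictionCategory.R1]
      · rw [Category.assoc, RestrictionCategory.R1]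

theorem add_le_add {A B : C} {f f' g g' : A ⟶ B} (hf : Le f' f) (hg : Le g' g) :
    Le (add f' g') (add f g) := by
  unfold Le at hf hg ⊢
  rw [LeftAdditiveRestrictionCategory.rest_add, LeftAdditiveRestrictionCategory.comp_add]
  conv_rhs => rw [add_eq]
  congr 1
  · rw [RestrictionCategory.R2, Category.assoc, hf]
  · rw [Category.assoc, hg]

end

section

variable [ProductOp C] [AdditiveOp C] [DifferentialOp C] [DifferentialRestrictionCategory C]

theorem D_le_D {A B : C} {f f' : A ⟶ B} (hf : Le f' f) : Le (D f') (D f) := by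
  unfold Le at hf ⊢
  have key : prodMap (𝟙 A) (rest f') ≫ π₁ A A = π₁ A A ≫ rest f' := by
    unfold prodMap
    rw [CartesianRestrictionCategory.pair_π₁, CartesianRestrictionCategory.rest_pair,
      Category.comp_id, CartesianRestrictionCategory.π₀_total, Category.id_comp,
      RestrictionCategory.R1]
  have key' : D (rest f' ≫ f) = prodMap (𝟙 A) (rest f') ≫ D f := by
    rw [DifferentialRestrictionCategory.DR5, DifferentialRestrictionCategory.DR8, ← key,
      ← comp_pair]
    have h1 : pair (π₀ A A) (π₁ A A) = 𝟙 (prod A A) := by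
      symm
      refine CartesianRestrictionCategory.pair_unique _ _ _ ?_ ?_ ?_
      · rw [rest_id]
      · rw [rest_id]
      · rw [rest_id, CartesianRestrictionCategory.π₀_total,
          CartesianRestrictionCategory.π₁_total, Category.comp_id]
    rw [h1, Category.comp_id]
  rw [DifferentialRestrictionCategory.DR9, ← key', hf]

end

end Facts

/-! ### Classical pieces and classical maps -/

section Classical

variable {X : Type u} [Category.{v} X] [RestrictionOp X]

/-- A classical piece `(f, f')`: a pair of maps with `f' ≤ f`. -/
@[ext]
structure Piece (A B : X) where
  fst : A ⟶ B
  snd : A ⟶ B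
  le : Le snd fst

section

variable [JoinRestrictionCategory X]

/-- `(k, a ∨ b)`, for `a, b ≤ k`. -/
noncomputable def Piece.mkJoin {A B : X} (k a b : A ⟶ B) (ha : Le a k) (hb : Le b k) :
    Piece A B :=
  ⟨k, join a b (compat_of_le ha hb), join_le _ ha hb⟩

/-- `(f, f') ⊥ (g, g')` iff `f̄ ḡ = f̄' ḡ ∨ f̄ ḡ'`. -/
def Piece.Disjoint {A B : X} (p q : Piece A B) : Prop :=
  rest p.fst ≫ rest q.fst =
    join (rest p.snd ≫ rest q.fst) (rest p.fst ≫ rest q.snd)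
      (compat_of_le (comp_le_comp (rest_le_rest p.le) (le_self _))
        (comp_le_comp (le_self _) (rest_le_rest q.le)))

/-- `(f, ∅)`. -/
noncomputable def Piece.ofMap {A B : X} (f : A ⟶ B) : Piece A B := ⟨f, empty A B, empty_le f⟩

/-- `(e f, e f')`, for a restriction idempotent `e`. -/
def Piece.inside {A B : X} (p : Piece A B) (e : A ⟶ A) : Piece A B :=
  ⟨e ≫ p.fst, e ≫ p.snd, comp_le_comp (le_self e) p.le⟩

/-- `(f, f' ∨ e f)`, for a restriction idempotent `e`. -/
noncomputable def Piece.outside {A B : X} (p : Piece A B) (e : A ⟶ A) (he : rest e = e) :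
    Piece A B :=
  Piece.mkJoin p.fst p.snd (e ≫ p.fst) p.le (by
    have h := le_rest_comp e p.fst
    rwa [he] at h)

/-- `(f, f')(g, g') = (f g, f' g ∨ f g')`. -/
noncomputable def Piece.comp {A B E : X} (p : Piece A B) (q : Piece B E) : Piece A E :=
  Piece.mkJoin (p.fst ≫ q.fst) (p.snd ≫ q.fst) (p.fst ≫ q.snd)
    (comp_le_comp p.le (le_self _)) (comp_le_comp (le_self _) q.le)

/-- The restriction `(f̄, f̄')`. -/
def Piece.restr {A B : X} (p : Piece A B) : Piece A A :=
  ⟨rest p.fst, rest p.snd, rest_le_rest p.le⟩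

end

/-- `⟨(f, f'), (g, g')⟩ = (⟨f, g⟩, ⟨f', g⟩ ∨ ⟨f, g'⟩)`. -/
noncomputable def Piece.pair [JoinRestrictionCategory X] [ProductOp X]
    [CartesianRestrictionCategory X] {Z A B : X} (p : Piece Z A) (q : Piece Z B) :
    Piece Z (prod A B) :=
  Piece.mkJoin (ProductOp.pair p.fst q.fst) (ProductOp.pair p.snd q.fst)
    (ProductOp.pair p.fst q.snd)
    (pair_le_pair p.le (le_self _)) (pair_le_pair (le_self _) q.le)

/-- `(f, f') + (g, g') = (f + g, (f' + g) ∨ (f + g'))`. -/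
noncomputable def Piece.add [JoinRestrictionCategory X] [AdditiveOp X]
    [LeftAdditiveRestrictionCategory X] {A B : X} (p q : Piece A B) : Piece A B :=
  Piece.mkJoin (AdditiveOp.add p.fst q.fst) (AdditiveOp.add p.snd q.fst)
    (AdditiveOp.add p.fst q.snd)
    (add_le_add p.le (le_self _)) (add_le_add (le_self _) q.le)

/-- `D[(f, f')] = (D[f], D[f'])`. -/
def Piece.D [ProductOp X] [AdditiveOp X] [DifferentialOp X] [DifferentialRestrictionCategory X]
    {A B : X} (p : Piece A B) : Piece (prod A A) B :=
  ⟨DifferentialOp.D p.fst, DifferentialOp.D p.snd, D_le_D p.le⟩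

section

variable [JoinRestrictionCategory X]

/-- A raw classical map `⨆ᵢ (fᵢ, fᵢ')`: a finite set of pairwise disjoint classical pieces. -/
structure Raw (A B : X) where
  pieces : Finset (Piece A B)
  disjoint : (pieces : Set (Piece A B)).Pairwise Piece.Disjoint

open Classical in
/-- The two rewriting rules, applied to one piece of a raw classical map.
Breaking: `(f, f') ⊔ R ≡ (e f, e f') ⊔ (f, f' ∨ e f) ⊔ R` for a restriction idempotent `e`.
Collapse: `(f, f) ⊔ R ≡ R`. -/
inductive Step {A B : X} : Raw A B → Raw A B → Prop
  | breaking (F G : Raw A B) (R : Finset (Piece A B)) (p : Piece A B) (hp : p ∉ R)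
      (e : A ⟶ A) (he : rest e = e) (hF : F.pieces = insert p R)
      (hG : G.pieces = insert (p.inside e) (insert (p.outside e he) R)) : Step F G
  | collapse (F G : Raw A B) (p : Piece A B) (hp : p ∉ G.pieces) (h : p.fst = p.snd)
      (hF : F.pieces = insert p G.pieces) : Step F G

/-- Classical maps: raw classical maps modulo the equivalence relation generated by breaking and
collapse. -/
def ClHom (A B : X) : Type v := Quot (Step (A := A) (B := B))

/-- The class of a raw classical map. -/
def ClHom.mk {A B : X} (F : Raw A B) : ClHom A B := Quot.mk _ F

/-- The class of `(f, ∅)`. -/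
noncomputable def ClHom.ofMap {A B : X} (f : A ⟶ B) : ClHom A B :=
  ClHom.mk ⟨{Piece.ofMap f}, by simp⟩

/-- The pieces in `s` are pairwise disjoint, and `c` is the class of `⨆ s`. -/
def ClHom.IsClassOf {A B : X} (c : ClHom A B) (s : Finset (Piece A B)) : Prop :=
  ∃ F : Raw A B, F.pieces = s ∧ ClHom.mk F = c

end

end Classical

/-! ### The classical completion -/

/-- The objects of `Cl(X)` are those of `X`. -/
structure Cl (X : Type u) where
  obj : X

section Completion

variable (X : Type u) [Category.{v} X] [RestrictionOp X] [ProductOp X] [AdditiveOp X]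
  [DifferentialOp X] [DifferentialJoinRestrictionCategory X]

open Classical in
/-- The operations of `Cl(X)`: operations on classical maps which are given on *all* representatives
by the formulas for composition, restriction, pairing, addition and differential. In particular
the formulas produce pairwise disjoint pieces and do not depend on the representatives. Since every
classical map is the class of a raw classical map, there is at most one choice of the operations.
The category laws are included, so that `Cl(X)` can be formed as a category. -/
structure ClOperations where
  comp : ∀ {A B E : X}, ClHom A B → ClHom B E → ClHom A E
  restr : ∀ {A B : X}, ClHom A B → ClHom A A
  pair : ∀ {Z A B : X}, ClHom Z A → ClHom Z B → ClHom Z (prod A B)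
  add : ∀ {A B : X}, ClHom A B → ClHom A B → ClHom A B
  diff : ∀ {A B : X}, ClHom A B → ClHom (prod A A) B
  comp_mk : ∀ {A B E : X} (F : Raw A B) (G : Raw B E),
    (comp (.mk F) (.mk G)).IsClassOf (Finset.image₂ Piece.comp F.pieces G.pieces)
  restr_mk : ∀ {A B : X} (F : Raw A B),
    (restr (.mk F)).IsClassOf (F.pieces.image Piece.restr)
  pair_mk : ∀ {Z A B : X} (F : Raw Z A) (G : Raw Z B),
    (pair (.mk F) (.mk G)).IsClassOf (Finset.image₂ Piece.pair F.pieces G.pieces)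
  add_mk : ∀ {A B : X} (F G : Raw A B),
    (add (.mk F) (.mk G)).IsClassOf (Finset.image₂ Piece.add F.pieces G.pieces)
  diff_mk : ∀ {A B : X} (F : Raw A B),
    (diff (.mk F)).IsClassOf (F.pieces.image Piece.D)
  id_comp : ∀ {A B : X} (c : ClHom A B), comp (.ofMap (𝟙 A)) c = c
  comp_id : ∀ {A B : X} (c : ClHom A B), comp c (.ofMap (𝟙 B)) = c
  assoc : ∀ {A B E F : X} (a : ClHom A B) (b : ClHom B E) (c : ClHom E F),
    comp (comp a b) c = comp a (comp b c)

variable {X}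

namespace ClOperations

variable (K : ClOperations X)

/-- The category `Cl(X)`; the identity of `A` is the class of `(1, ∅)`. -/
noncomputable abbrev category : Category.{v} (Cl X) where
  Hom A B := ClHom A.obj B.obj
  id A := ClHom.ofMap (𝟙 A.obj)
  comp a b := K.comp a b
  id_comp := K.id_comp
  comp_id := K.comp_id
  assoc := K.assoc

/-- Restriction in `Cl(X)`. -/
abbrev restrictionOp : @RestrictionOp (Cl X) K.category :=
  letI := K.category
  { rest := fun {A B} (c : ClHom A.obj B.obj) => K.restr c }

/-- The terminal object and the products of `Cl(X)` are those of `X`, with terminal maps `(!, ∅)` and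
projections `(π₀, ∅)`, `(π₁, ∅)`. -/
noncomputable abbrev productOp : @ProductOp (Cl X) K.category :=
  letI := K.category
  { T := ⟨T⟩
    bang := fun A => ClHom.ofMap (bang A.obj)
    prod := fun A B => ⟨prod A.obj B.obj⟩
    π₀ := fun A B => ClHom.ofMap (π₀ A.obj B.obj)
    π₁ := fun A B => ClHom.ofMap (π₁ A.obj B.obj)
    pair := fun {Z A B} (c : ClHom Z.obj A.obj) (d : ClHom Z.obj B.obj) => K.pair c d }

/-- Addition in `Cl(X)`; the zero maps are `(0, ∅)`. -/
noncomputable abbrev additiveOp : @AdditiveOp (Cl X) K.category :=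
  letI := K.category
  { add := fun {A B} (c d : ClHom A.obj B.obj) => K.add c d
    zero := fun A B => ClHom.ofMap (zero A.obj B.obj) }

/-- The differential of `Cl(X)`, `⨆ᵢ (fᵢ, fᵢ') ↦ ⨆ᵢ (D[fᵢ], D[fᵢ'])`. -/
abbrev differentialOp : @DifferentialOp (Cl X) K.category K.productOp :=
  letI := K.category
  letI := K.productOp
  { D := fun {A B} (c : ClHom A.obj B.obj) => K.diff c }

/-- `Cl(X)`, with these operations, is a differential join restriction category. -/
def IsDifferentialJoinRestrictionCategory : Prop :=
  @DifferentialJoinRestrictionCategory (Cl X) K.category K.restrictionOp K.productOp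
    K.additiveOp K.differentialOp

end ClOperations

end Completion

end DiffRestr

namespace DiffRestr

open RestrictionOp ProductOp AdditiveOp DifferentialOp

/-! ### Restriction order and joins -/

section Order

variable {X : Type u} [Category.{v} X] [RestrictionOp X]

section

variable {A B : X}

/-! A classical piece $(f,f')$ stands for the restriction of $f$ to the difference $\overline
f\setminus\overline{f'}$, which need not be the domain of a map of $\mathbb X$. Points make this
literal. The restriction idempotents of an object form a distributive lattice, whose prime filters
(the empty one included) serve as points. A piece is defined at the points containing $\overline f$
but not $\overline{f'}$, and there it carries the germ of $f$. The prime ideal theorem supplies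
enough points, so that disjointness of pieces is disjointness of regions (`Piece.disjoint_iff`) and
the collapsible pieces are those with empty region (`Piece.fst_eq_snd_iff`).

Breaking and collapse preserve germs (`Step.germAt_iff`). The heart of the proof is the converse,
`equivalent_of_germAt`: raw classical maps with the same germs at all points are equivalent. Cutting
along the domains of the pieces reduces it to two single pieces with the same germs. For these a
compactness argument (`Piece.exists_idem_of_agree`) turns pointwise agreement into agreement on one
idempotent that covers the common region. A classical map is therefore the same thing as its partial
germ-valued function on points (`ClHom.ext_germ`).

Each operation acts pointwise on germs, where composition and $D$ move the point along a map
(`germAt_comp`, `germAt_diff` and their analogues). This gives independence of representatives at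
once. Every equational law of $\mathbf{Cl}(\mathbb X)$ then follows by comparing domains of
definition and applying the same law of $\mathbb X$ to germs (`ClHom.ext_def`). The order becomes
inclusion of germs and compatibility becomes agreement of germs. Joins are unions, which exist
because one classical map can be cut down to the points where another is undefined
(`exists_difference`). -/

theorem Le.eq_of_rest_eq {f g k : A ⟶ B} (hf : Le f k) (hg : Le g k) (h : rest f = rest g) :
    f = g := by
  unfold Le at hf hg
  rw [← hf, h, hg]

theorem idem_le_id {e : A ⟶ A} (he : rest e = e) : Le e (𝟙 A) := by
  unfold Le
  rw [he, Category.comp_id]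

theorem rest_eq_of_le_id {e : A ⟶ A} (h : Le e (𝟙 A)) : rest e = e := by
  unfold Le at h
  rwa [Category.comp_id] at h

theorem le_iff_comp_eq {e e' : A ⟶ A} (he : rest e = e) : Le e e' ↔ e ≫ e' = e := by
  unfold Le
  rw [he]

end

section

variable [RestrictionCategory X] {A B E : X}

theorem Le.antisymm {f g : A ⟶ B} (h : Le f g) (h' : Le g f) : f = g := by
  unfold Le at h h'
  calc f = rest f ≫ rest g ≫ f := by rw [h', h]
    _ = rest g ≫ f := by
      rw [← Category.assoc, RestrictionCategory.R2, Category.assoc, RestrictionCategory.R1]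
    _ = g := h'

theorem Le.rest_comp_rest {f g : A ⟶ B} (h : Le f g) : rest f ≫ rest g = rest f := by
  rw [← RestrictionCategory.R3, h]

theorem Le.trans {f g h : A ⟶ B} (h₁ : Le f g) (h₂ : Le g h) : Le f h := by
  have h₃ := h₁.rest_comp_rest
  unfold Le at *
  rw [← h₃, Category.assoc, h₂, h₁]

theorem rest_comp_self {e : A ⟶ A} (he : rest e = e) : e ≫ e = e := by
  have h := RestrictionCategory.R1 e
  rwa [he] at h

theorem idem_comm {e e' : A ⟶ A} (he : rest e = e) (he' : rest e' = e') : e ≫ e' = e' ≫ e := by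
  rw [← he, ← he', RestrictionCategory.R2]

theorem rest_idem_comp {e : A ⟶ A} (he : rest e = e) (f : A ⟶ B) :
    rest (e ≫ f) = e ≫ rest f := by
  conv_lhs => rw [← he, RestrictionCategory.R3, he]

theorem idem_comp_le {e : A ⟶ A} (he : rest e = e) (f : A ⟶ B) : Le (e ≫ f) f := by
  rw [← he]
  exact le_rest_comp e f

theorem rest_comp_rest_right (f : A ⟶ B) {E' : X} (g : B ⟶ E) (h : B ⟶ E') :
    rest (f ≫ rest g ≫ h) = rest (f ≫ g) ≫ rest (f ≫ h) := by
  rw [← Category.assoc, RestrictionCategory.R4, Category.assoc, RestrictionCategory.R3]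

theorem Compat.comp_left {f g : A ⟶ B} (h : Compat f g) {Z : X} (k : Z ⟶ A) :
    Compat (k ≫ f) (k ≫ g) := by
  unfold Compat at *
  rw [← Category.assoc, ← Category.assoc, ← RestrictionCategory.R4, ← RestrictionCategory.R4,
    Category.assoc, Category.assoc, h]

end

variable [JoinRestrictionCategory X] {A B E : X}

theorem IsJoin.unique {s : Set (A ⟶ B)} {j k : A ⟶ B} (hj : IsJoin s j) (hk : IsJoin s k) :
    j = k :=
  (hj.2 k hk.1).antisymm (hk.2 j hj.1)

theorem le_join_left {f g : A ⟶ B} (h : Compat f g) : Le f (join f g h) :=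
  (join_isJoin f g h).1 f (by simp)

theorem le_join_right {f g : A ⟶ B} (h : Compat f g) : Le g (join f g h) :=
  (join_isJoin f g h).1 g (by simp)

theorem comp_join {Z : X} (k : Z ⟶ A) {f g : A ⟶ B} (h : Compat f g) :
    k ≫ join f g h = join (k ≫ f) (k ≫ g) (h.comp_left k) := by
  have h₁ : IsJoin ((fun f => k ≫ f) '' {f, g}) (k ≫ join f g h) :=
    (JoinRestrictionCategory.exists_join {f, g} (Set.toFinite _) (by
      rintro a (rfl | rfl) b (rfl | rfl)
      exacts [rfl, h, h.symm, rfl])).choose_spec.2 k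
  rw [Set.image_pair] at h₁
  exact h₁.unique (join_isJoin _ _ _)

theorem comp_empty {Z : X} (k : Z ⟶ A) : k ≫ empty A B = empty Z B := by
  have h₁ : IsJoin ((fun f => k ≫ f) '' ∅) (k ≫ empty A B) :=
    (JoinRestrictionCategory.exists_join (∅ : Set (A ⟶ B)) (Set.toFinite _)
      (fun _ h => h.elim)).choose_spec.2 k
  rw [Set.image_empty] at h₁
  exact (h₁.2 _ (fun _ h => h.elim)).antisymm (empty_le _)

theorem rest_empty : rest (empty A B) = empty A A := by
  have h₂ : rest (empty A A) = empty A A := rest_eq_of_le_id (empty_le _)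
  have h₁ : rest (empty A B) = empty A A ≫ rest (empty A B) := by
    rw [← rest_idem_comp h₂, comp_empty]
  rw [h₁, idem_comm h₂ (rest_rest _), comp_empty]

theorem compat_rest (f : A ⟶ B) (g : A ⟶ E) : Compat (rest f) (rest g) := by
  unfold Compat
  rw [rest_rest, rest_rest, RestrictionCategory.R2]

theorem rest_join_idem {e e' : A ⟶ A} (he : rest e = e) (he' : rest e' = e')
    (h : Compat e e') : rest (join e e' h) = join e e' h :=
  rest_eq_of_le_id (join_le h (idem_le_id he) (idem_le_id he'))

/-- Only precomposition is assumed to preserve joins, so the domain is computed indirectly. With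
$e=\overline f\vee\overline g$, both $f=\overline f f$ and $g=\overline g g$ lie below $e(f\vee g)$.
Hence so does $f\vee g$, and its domain lies below $e$. -/
theorem rest_join {f g : A ⟶ B} (h : Compat f g) :
    rest (join f g h) = join (rest f) (rest g) (compat_rest f g) := by
  refine Le.antisymm ?_
    (join_le _ (rest_le_rest (le_join_left h)) (rest_le_rest (le_join_right h)))
  have he := rest_join_idem (rest_rest f) (rest_rest g) (compat_rest f g)
  have aux : Le (join f g h) (join (rest f) (rest g) (compat_rest f g) ≫ join f g h) := by
    refine join_le h ?_ ?_
    · have := comp_le_comp (le_join_left (compat_rest f g)) (le_join_left h)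
      rwa [RestrictionCategory.R1] at this
    · have := comp_le_comp (le_join_right (compat_rest f g)) (le_join_right h)
      rwa [RestrictionCategory.R1] at this
  have h₁ := rest_le_rest aux
  rw [rest_idem_comp he, idem_comm he (rest_rest _)] at h₁
  exact h₁.trans (idem_comp_le (rest_rest _) _)

theorem compat_idem {e e' : A ⟶ A} (he : rest e = e) (he' : rest e' = e') : Compat e e' :=
  compat_of_le (idem_le_id he) (idem_le_id he')

end Order

/-! ### Prime filters of restriction idempotents -/

section Points

variable {X : Type u} [Category.{v} X] [RestrictionOp X] [JoinRestrictionCategory X]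

/-- The restriction idempotents of an object. -/
def Idem (A : X) : Type v := {e : A ⟶ A // rest e = e}

noncomputable instance (A : X) : Lattice (Idem A) :=
  { le := fun a b => a.1 ≫ b.1 = a.1
    le_refl := fun a => rest_comp_self a.2
    le_trans := fun a b c h h' =>
      (le_iff_comp_eq a.2).1 (((le_iff_comp_eq a.2).2 h).trans ((le_iff_comp_eq b.2).2 h'))
    le_antisymm := fun a b h h' =>
      Subtype.ext (((le_iff_comp_eq a.2).2 h).antisymm ((le_iff_comp_eq b.2).2 h'))
    inf := fun a b => ⟨a.1 ≫ b.1, by rw [rest_idem_comp a.2, b.2]⟩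
    inf_le_left := fun a b => by
      change (a.1 ≫ b.1) ≫ a.1 = a.1 ≫ b.1
      rw [idem_comm a.2 b.2, Category.assoc, rest_comp_self a.2]
    inf_le_right := fun a b => by
      change (a.1 ≫ b.1) ≫ b.1 = a.1 ≫ b.1
      rw [Category.assoc, rest_comp_self b.2]
    le_inf := fun a b c h h' => by
      change a.1 ≫ b.1 ≫ c.1 = a.1
      rw [← Category.assoc, h, h']
    sup := fun a b => ⟨join a.1 b.1 (compat_idem a.2 b.2), rest_join_idem a.2 b.2 _⟩
    le_sup_left := fun a b => (le_iff_comp_eq a.2).1 (le_join_left (compat_idem a.2 b.2))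
    le_sup_right := fun a b => (le_iff_comp_eq b.2).1 (le_join_right (compat_idem a.2 b.2))
    sup_le := fun a b c h h' => (le_iff_comp_eq (rest_join_idem a.2 b.2 (compat_idem a.2 b.2))).1
      (join_le _ ((le_iff_comp_eq a.2).2 h) ((le_iff_comp_eq b.2).2 h')) }

/-- Meets are composites, so distributivity is preservation of joins by precomposition with an
idempotent. -/
noncomputable instance (A : X) : DistribLattice (Idem A) :=
  DistribLattice.ofInfSupLe fun a b c => by
    refine (le_iff_comp_eq (a ⊓ (b ⊔ c)).2).1 ?_
    have h := comp_join a.1 (compat_idem b.2 c.2)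
    have hle := le_self (a.1 ≫ join b.1 c.1 (compat_idem b.2 c.2))
    conv at hle => arg 2; rw [h]
    exact hle

/-- A point of `A`: a prime filter of restriction idempotents, extended to all endomaps along
`e ↦ ē`. The empty filter is allowed, so that points can be pushed along partial maps. -/
@[ext]
structure Point (A : X) where
  mem : (A ⟶ A) → Prop
  mem_rest : ∀ e, mem (rest e) ↔ mem e
  mem_comp : ∀ e e', mem (rest e ≫ rest e') ↔ mem e ∧ mem e'
  mem_join : ∀ e e' (h : Compat e e'), mem (join e e' h) ↔ mem e ∨ mem e'
  not_mem_empty : ¬ mem (empty A A)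

namespace Point

variable {A B E : X}

/-- The domain of `f` belongs to the point `x`. -/
def Has (x : Point A) (f : A ⟶ B) : Prop := x.mem (rest f)

theorem has_endo {x : Point A} {e : A ⟶ A} : x.Has e ↔ x.mem e := x.mem_rest e

@[simp]
theorem has_rest {x : Point A} {f : A ⟶ B} : x.Has (rest f) ↔ x.Has f := has_endo

@[simp]
theorem has_rest_comp {x : Point A} {f : A ⟶ B} {g : A ⟶ E} :
    x.Has (rest f ≫ g) ↔ x.Has f ∧ x.Has g := by
  unfold Has
  rw [RestrictionCategory.R3, ← rest_rest f, ← rest_rest g, x.mem_comp, rest_rest, rest_rest]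

theorem has_idem_comp {x : Point A} {e : A ⟶ A} (he : rest e = e) {g : A ⟶ E} :
    x.Has (e ≫ g) ↔ x.mem e ∧ x.Has g := by
  conv_lhs => rw [← he]
  rw [has_rest_comp, has_endo]

@[simp]
theorem has_join {x : Point A} {f g : A ⟶ B} (h : Compat f g) :
    x.Has (join f g h) ↔ x.Has f ∨ x.Has g := by
  unfold Has
  rw [rest_join, x.mem_join]

@[simp]
theorem not_has_empty {x : Point A} : ¬ x.Has (empty A B) := by
  unfold Has
  rw [rest_empty]
  exact x.not_mem_empty

theorem Has.mono {x : Point A} {f g : A ⟶ B} (hf : x.Has f) (h : Le f g) : x.Has g := by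
  unfold Le at h
  rw [← h] at hf
  exact (has_rest_comp.1 hf).2

theorem Has.left {x : Point A} {f : A ⟶ B} {g : B ⟶ E} (h : x.Has (f ≫ g)) : x.Has f := by
  rw [← RestrictionCategory.R1 f, Category.assoc] at h
  exact (has_rest_comp.1 h).1

/-- The hypothesis on `f` excludes the empty filter, at which not even total maps are defined. -/
theorem Has.total {x : Point A} {f : A ⟶ B} (h : x.Has f) {g : A ⟶ E} (hg : Total g) :
    x.Has g := by
  have : x.Has (rest f ≫ g) := by
    unfold Has
    unfold Total at hg
    rw [RestrictionCategory.R3, hg, Category.comp_id]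
    exact h
  exact (has_rest_comp.1 this).2

/-- The image of a point under a partial map. -/
def push (x : Point A) (f : A ⟶ B) : Point B where
  mem e := x.Has (f ≫ e)
  mem_rest e := by
    unfold Has
    rw [rest_comp_rest]
  mem_comp e e' := by
    rw [← has_rest_comp]
    unfold Has
    rw [rest_comp_rest_right, rest_comp_rest, RestrictionCategory.R3]
  mem_join e e' h := by
    rw [comp_join, has_join]
  not_mem_empty := by
    rw [comp_empty]
    exact not_has_empty

@[simp]
theorem has_push {x : Point A} {f : A ⟶ B} {g : B ⟶ E} :
    (x.push f).Has g ↔ x.Has (f ≫ g) := by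
  change x.mem (rest (f ≫ rest g)) ↔ x.mem (rest (f ≫ g))
  rw [rest_comp_rest]

theorem push_push (x : Point A) (f : A ⟶ B) (g : B ⟶ E) :
    (x.push f).push g = x.push (f ≫ g) := by
  ext e
  change (x.push f).Has (g ≫ e) ↔ x.Has ((f ≫ g) ≫ e)
  rw [has_push, Category.assoc]

theorem push_id (x : Point A) : x.push (𝟙 A) = x := by
  ext e
  change x.Has (𝟙 A ≫ e) ↔ _
  rw [Category.id_comp, has_endo]

/-- `f` and `g` have the same germ at `x`. -/
def Agree (x : Point A) (f g : A ⟶ B) : Prop :=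
  ∃ e : A ⟶ A, rest e = e ∧ x.mem e ∧ e ≫ f = e ≫ g

theorem Agree.symm {x : Point A} {f g : A ⟶ B} (h : x.Agree f g) : x.Agree g f := by
  obtain ⟨e, he, hx, h⟩ := h
  exact ⟨e, he, hx, h.symm⟩

theorem Agree.trans {x : Point A} {f g h : A ⟶ B} (h₁ : x.Agree f g) (h₂ : x.Agree g h) :
    x.Agree f h := by
  obtain ⟨e, he, hx, h₁⟩ := h₁
  obtain ⟨e', he', hx', h₂⟩ := h₂
  refine ⟨e ≫ e', by rw [rest_idem_comp he, he'], ?_, ?_⟩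
  · rw [← he, ← he', x.mem_comp]
    exact ⟨hx, hx'⟩
  · rw [idem_comm he he', Category.assoc, h₁, ← Category.assoc, idem_comm he' he, Category.assoc,
      h₂, Category.assoc]

/-- Reflexivity of `Agree` fails at the empty filter, since a witnessing idempotent must belong to
the point. -/
theorem Has.agree_refl {x : Point A} {f : A ⟶ B} (h : x.Has f) {g : A ⟶ E} : x.Agree g g :=
  ⟨rest f, rest_rest f, h, rfl⟩

theorem agree_of_rest {x : Point A} {f g : A ⟶ B} {h : A ⟶ E} (hx : x.Has h)
    (e : rest h ≫ f = rest h ≫ g) : x.Agree f g :=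
  ⟨rest h, rest_rest h, hx, e⟩

theorem Has.agree_rest_comp {x : Point A} {h : A ⟶ E} (hx : x.Has h) (f : A ⟶ B) :
    x.Agree (rest h ≫ f) f :=
  agree_of_rest hx (by rw [← Category.assoc, rest_comp_self (rest_rest h)])

theorem Has.agree_of_le {x : Point A} {f g : A ⟶ B} (hx : x.Has f) (h : Le f g) :
    x.Agree f g :=
  agree_of_rest hx (by rw [RestrictionCategory.R1, h])

theorem Agree.has {x : Point A} {f g : A ⟶ B} (h : x.Agree f g) (hf : x.Has f) : x.Has g := by
  obtain ⟨e, he, hx, h⟩ := h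
  have h₁ : x.Has (e ≫ f) := (has_idem_comp he).2 ⟨hx, hf⟩
  rw [h] at h₁
  exact ((has_idem_comp he).1 h₁).2

theorem Agree.comp_right {x : Point A} {f f' : A ⟶ B} (h : x.Agree f f') (g : B ⟶ E) :
    x.Agree (f ≫ g) (f' ≫ g) := by
  obtain ⟨e, he, hx, h⟩ := h
  exact ⟨e, he, hx, by rw [← Category.assoc, h, Category.assoc]⟩

/-- An idempotent $e$ on which $g$ and $g'$ agree is pulled back to $\overline{fe}$, because
$\overline{fe}\,f=f\overline e$ by `R4`. -/
theorem Agree.comp_left {x : Point A} {f : A ⟶ B} {g g' : B ⟶ E} (h : (x.push f).Agree g g') :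
    x.Agree (f ≫ g) (f ≫ g') := by
  obtain ⟨e, he, hx, h⟩ := h
  refine agree_of_rest (h := f ≫ e) hx ?_
  rw [← Category.assoc, ← Category.assoc, ← RestrictionCategory.R4, he, Category.assoc,
    Category.assoc, h]

theorem Agree.push_eq {x : Point A} {f f' : A ⟶ B} (h : x.Agree f f') : x.push f = x.push f' := by
  ext e
  exact ⟨(h.comp_right e).has, (h.symm.comp_right e).has⟩

theorem Agree.comp {x : Point A} {f f' : A ⟶ B} {g g' : B ⟶ E} (hf : x.Agree f f')
    (hg : (x.push f).Agree g g') : x.Agree (f ≫ g) (f' ≫ g') :=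
  hg.comp_left.trans (hf.comp_right g')

theorem Agree.rest_congr {x : Point A} {f f' : A ⟶ B} (h : x.Agree f f') :
    x.Agree (rest f) (rest f') := by
  obtain ⟨e, he, hx, h⟩ := h
  exact ⟨e, he, hx, by rw [← rest_idem_comp he, h, rest_idem_comp he]⟩

theorem Has.agree_rest_id {x : Point A} {f : A ⟶ B} (h : x.Has f) : x.Agree (rest f) (𝟙 A) :=
  agree_of_rest h (by rw [rest_comp_self (rest_rest f), Category.comp_id])

theorem agree_of_compat {f g : A ⟶ B} (h : Compat f g) {x : Point A} (hf : x.Has f)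
    (hg : x.Has g) : x.Agree f g := by
  have h₁ := hg.agree_rest_comp f
  rw [← show rest f ≫ g = rest g ≫ f from h] at h₁
  exact h₁.symm.trans (hf.agree_rest_comp g)

/-- Prime filter theorem: an idempotent outside an ideal lies in a point avoiding the ideal. -/
theorem exists_point (I : (A ⟶ A) → Prop) (h₀ : I (empty A A))
    (hmono : ∀ e e', rest e = e → rest e' = e' → Le e e' → I e' → I e)
    (hjoin : ∀ e e' (h : Compat e e'), rest e = e → rest e' = e' → I e → I e' →
      I (join e e' h))
    {k : A ⟶ A} (hk : rest k = k) (hkI : ¬ I k) :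
    ∃ x : Point A, x.mem k ∧ ∀ e, rest e = e → I e → ¬ x.mem e := by
  let J₀ : Order.Ideal (Idem A) :=
    { carrier := {e | I e.1}
      lower' := fun a b hba ha => hmono _ _ b.2 a.2 ((le_iff_comp_eq b.2).2 hba) ha
      nonempty' := ⟨⟨empty A A, rest_empty⟩, h₀⟩
      directed' := fun a ha b hb => 
        ⟨a ⊔ b, hjoin _ _ (compat_idem a.2 b.2) a.2 b.2 ha hb, le_sup_left, le_sup_right⟩ }
  have hdis : Disjoint ((Order.PFilter.principal (⟨k, hk⟩ : Idem A) : Order.PFilter (Idem A)) :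
      Set (Idem A)) (J₀ : Set (Idem A)) := by
    rw [Set.disjoint_left]
    intro a ha haI
    exact hkI (hmono _ _ hk a.2 ((le_iff_comp_eq hk).2 (Order.PFilter.mem_principal.1 ha)) haI)
  obtain ⟨J, hJ, hIJ, hdJ⟩ := DistribLattice.prime_ideal_of_disjoint_filter_ideal hdis
  have hkJ : (⟨k, hk⟩ : Idem A) ∉ J :=
    Set.disjoint_left.1 hdJ (Order.PFilter.mem_principal.2 le_rfl)
  let q : (A ⟶ A) → Idem A := fun e => ⟨rest e, rest_rest e⟩
  have hq : ∀ e (he : rest e = e), q e = ⟨e, he⟩ := fun e he => Subtype.ext he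
  -- The point is the complement of the prime ideal, extended to all endomaps by testing their
  -- domains.
  refine ⟨⟨fun e => q e ∉ J, fun e => ?_, fun e e' => ?_, fun e e' h => ?_, ?_⟩, ?_, ?_⟩
  · rw [hq (rest e) (rest_rest e)]
  · have : q (rest e ≫ rest e') = q e ⊓ q e' := Subtype.ext (by
      change rest (rest e ≫ rest e') = rest e ≫ rest e'
      rw [RestrictionCategory.R3, rest_rest])
    rw [this, ← not_or, not_iff_not]
    exact ⟨hJ.mem_or_mem, fun h => h.elim (J.lower inf_le_left) (J.lower inf_le_right)⟩
  · have : q (join e e' h) = q e ⊔ q e' := Subtype.ext (rest_join h)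
    rw [this, ← not_and_or, not_iff_not, Order.Ideal.sup_mem_iff]
  · rw [not_not, hq _ rest_empty]
    exact hIJ h₀
  · change q k ∉ J
    rwa [hq k hk]
  · intro e he hIe
    change ¬ (q e ∉ J)
    rw [not_not, hq e he]
    exact hIJ hIe

/-- There are enough points: if $\overline f\not\le\overline g$, some point contains $\overline f$
and avoids the ideal of all idempotents below $\overline g$. -/
theorem rest_le_of_has {f : A ⟶ B} {g : A ⟶ E} (h : ∀ x : Point A, x.Has f → x.Has g) :
    Le (rest f) (rest g) := by
  by_contra hc
  obtain ⟨x, hx, hI⟩ := exists_point (fun e => Le e (rest g)) (empty_le _)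
    (fun _ _ _ _ h h' => h.trans h') (fun _ _ _ _ _ h h' => join_le _ h h') (rest_rest f) hc
  exact hI _ (rest_rest g) (le_self _) (h x hx)

theorem rest_eq_of_has {f : A ⟶ B} {g : A ⟶ E} (h : ∀ x : Point A, x.Has f ↔ x.Has g) :
    rest f = rest g :=
  (rest_le_of_has fun x => (h x).1).antisymm (rest_le_of_has fun x => (h x).2)

/-- Under a common upper bound a map is determined by its domain, and the domain by its points.
Identities between joins thereby become propositional logic at a point. -/
theorem eq_of_le_of_has {f g k : A ⟶ B} (hf : Le f k) (hg : Le g k)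
    (h : ∀ x : Point A, x.Has f ↔ x.Has g) : f = g :=
  hf.eq_of_rest_eq hg (rest_eq_of_has h)

/-- Postcomposition preserves joins as well, although this is not an axiom. The join of $fk$ and
$gk$ lies below $(f\vee g)k$ and has the same points in its domain, since at each point $f\vee g$
has the germ of $f$ or of $g$. The two-sided form is what gluing agreements over two idempotents
requires. -/
theorem join_comp {f g : A ⟶ B} (h : Compat f g) {f' g' : A ⟶ B} (h' : Compat f' g') (k l : B ⟶ E)
    (hf : f ≫ k = f' ≫ l) (hg : g ≫ k = g' ≫ l) : join f g h ≫ k = join f' g' h' ≫ l := by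
  have aux : ∀ {f g : A ⟶ B} (h : Compat f g) (k : B ⟶ E) (m : A ⟶ E), Le (f ≫ k) m →
      Le (g ≫ k) m → Le (join f g h ≫ k) m := by
    intro f g h k m hf hg
    have hc : Compat (f ≫ k) (g ≫ k) := compat_of_le hf hg
    have hle : Le (join (f ≫ k) (g ≫ k) hc) (join f g h ≫ k) :=
      join_le hc (comp_le_comp (le_join_left h) (le_self k))
        (comp_le_comp (le_join_right h) (le_self k))
    rw [← eq_of_le_of_has hle (le_self _) fun x => ?_]
    · exact join_le hc hf hg
    rw [has_join]
    refine ⟨fun hx => hx.elim (fun hx => hx.mono (comp_le_comp (le_join_left h) (le_self k)))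
      fun hx => hx.mono (comp_le_comp (le_join_right h) (le_self k)), fun hx => ?_⟩
    rcases (has_join h).1 hx.left with hf | hg
    · exact .inl (((hf.agree_of_le (le_join_left h)).symm.comp_right k).has hx)
    · exact .inr (((hg.agree_of_le (le_join_right h)).symm.comp_right k).has hx)
  refine (aux h k _ ?_ ?_).antisymm (aux h' l _ ?_ ?_)
  · rw [hf]; exact comp_le_comp (le_join_left h') (le_self l)
  · rw [hg]; exact comp_le_comp (le_join_right h') (le_self l)
  · rw [← hf]; exact comp_le_comp (le_join_left h) (le_self k)
  · rw [← hg]; exact comp_le_comp (le_join_right h) (le_self k)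

end Point

end Points

section Germs

variable {X : Type u} [Category.{v} X] [RestrictionOp X] [JoinRestrictionCategory X] {A B : X}

/-! ### Regions and germs of pieces -/

namespace Piece

/-- The points at which a piece `(f, f')` is defined: those in `f̄` but not in `f̄'`. -/
def Reg (p : Piece A B) (x : Point A) : Prop := x.Has p.fst ∧ ¬ x.Has p.snd

/-- The piece `p` is defined at `x`, with the germ of `f`. -/
def At (p : Piece A B) (x : Point A) (f : A ⟶ B) : Prop := p.Reg x ∧ x.Agree p.fst f

theorem Reg.at {p : Piece A B} {x : Point A} (h : p.Reg x) : p.At x p.fst :=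
  ⟨h, h.1.agree_refl⟩

theorem reg_mkJoin {k a b : A ⟶ B} (ha : Le a k) (hb : Le b k) {x : Point A} :
    (mkJoin k a b ha hb).Reg x ↔ x.Has k ∧ ¬ x.Has a ∧ ¬ x.Has b := by
  unfold Reg mkJoin
  rw [Point.has_join, not_or]

theorem reg_inside {p : Piece A B} {e : A ⟶ A} (he : rest e = e) {x : Point A} :
    (p.inside e).Reg x ↔ x.mem e ∧ p.Reg x := by
  unfold Reg inside
  rw [Point.has_idem_comp he, Point.has_idem_comp he]
  tauto

theorem reg_outside {p : Piece A B} {e : A ⟶ A} (he : rest e = e) {x : Point A} :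
    (p.outside e he).Reg x ↔ ¬ x.mem e ∧ p.Reg x := by
  unfold outside
  rw [reg_mkJoin, Point.has_idem_comp he]
  unfold Reg
  tauto

theorem at_inside {p : Piece A B} {e : A ⟶ A} (he : rest e = e) {x : Point A} {f : A ⟶ B} :
    (p.inside e).At x f ↔ x.mem e ∧ p.At x f := by
  unfold At
  rw [reg_inside he, and_assoc]
  refine and_congr_right fun hx => and_congr_right fun _ => ?_
  have h : x.Agree (e ≫ p.fst) p.fst :=
    ⟨e, he, hx, by rw [← Category.assoc, rest_comp_self he]⟩
  exact ⟨fun h' => h.symm.trans h', fun h' => h.trans h'⟩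

theorem at_outside {p : Piece A B} {e : A ⟶ A} (he : rest e = e) {x : Point A} {f : A ⟶ B} :
    (p.outside e he).At x f ↔ ¬ x.mem e ∧ p.At x f := by
  unfold At
  rw [reg_outside he, and_assoc]
  rfl

/-- At a point, the join equation says that when both $f$ and $g$ are defined, so is $f'$ or $g'$.
The converse direction needs enough points. -/
theorem disjoint_iff {p q : Piece A B} : p.Disjoint q ↔ ∀ x, p.Reg x → ¬ q.Reg x := by
  constructor
  · intro h x hp hq
    have hx : x.Has (rest p.fst ≫ rest q.fst) := by simp [hp.1, hq.1]
    rw [h] at hx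
    simp [hp.2, hq.2] at hx
  · intro h
    have h₁ : Le (rest p.snd ≫ rest q.fst) (rest p.fst ≫ rest q.fst) :=
      comp_le_comp (rest_le_rest p.le) (le_self _)
    have h₂ : Le (rest p.fst ≫ rest q.snd) (rest p.fst ≫ rest q.fst) :=
      comp_le_comp (le_self _) (rest_le_rest q.le)
    refine Point.eq_of_le_of_has (le_self _) (join_le _ h₁ h₂) fun x => ?_
    have hx := h x
    have hp : x.Has p.snd → x.Has p.fst := fun h => h.mono p.le
    have hq : x.Has q.snd → x.Has q.fst := fun h => h.mono q.le
    unfold Reg at hx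
    simp only [Point.has_rest_comp, Point.has_rest, Point.has_join]
    tauto

theorem fst_eq_snd_iff {p : Piece A B} : p.fst = p.snd ↔ ∀ x, ¬ p.Reg x := by
  constructor
  · rintro h x ⟨h₁, h₂⟩
    exact h₂ (h ▸ h₁)
  · intro h
    refine Point.eq_of_le_of_has (le_self _) p.le fun x => ?_
    have hx := h x
    have hp : x.Has p.snd → x.Has p.fst := fun h => h.mono p.le
    unfold Reg at hx
    tauto

end Piece

/-! ### Equivalence of finite sets of pieces -/

/-- The pieces of `S` are pairwise disjoint. -/
abbrev PairwiseDisj (S : Finset (Piece A B)) : Prop := (S : Set (Piece A B)).Pairwise Piece.Disjoint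

/-- Some piece of `S` is defined at `x`, with the germ of `f`. -/
def GermAt (S : Finset (Piece A B)) (x : Point A) (f : A ⟶ B) : Prop := ∃ p ∈ S, p.At x f

/-- Some piece of `S` is defined at `x`. -/
def DefinedAt (S : Finset (Piece A B)) (x : Point A) : Prop := ∃ p ∈ S, p.Reg x

theorem definedAt_iff {S : Finset (Piece A B)} {x : Point A} :
    DefinedAt S x ↔ ∃ f, GermAt S x f :=
  ⟨fun ⟨p, hp, h⟩ => ⟨p.fst, p, hp, h.at⟩, fun ⟨_, p, hp, h⟩ => ⟨p, hp, h.1⟩⟩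

theorem pairwiseDisj_iff {S : Finset (Piece A B)} :
    PairwiseDisj S ↔ ∀ x, ∀ p ∈ S, ∀ q ∈ S, p.Reg x → q.Reg x → p = q := by
  constructor
  · intro h x p hp q hq hpx hqx
    by_contra hne
    exact Piece.disjoint_iff.1 (h hp hq hne) x hpx hqx
  · intro h p hp q hq hne
    exact Piece.disjoint_iff.2 fun x hpx hqx => hne (h x p hp q hq hpx hqx)

theorem PairwiseDisj.subset {S T : Finset (Piece A B)} (h : PairwiseDisj T) (hs : S ⊆ T) :
    PairwiseDisj S :=
  Set.Pairwise.mono (Finset.coe_subset.2 hs) h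

/-- `S` and `T` are sets of pairwise disjoint pieces representing the same classical map. -/
def Equivalent (S T : Finset (Piece A B)) : Prop :=
  ∃ F G : Raw A B, F.pieces = S ∧ G.pieces = T ∧ ClHom.mk F = ClHom.mk G

theorem Equivalent.refl {S : Finset (Piece A B)} (h : PairwiseDisj S) : Equivalent S S :=
  ⟨⟨S, h⟩, ⟨S, h⟩, rfl, rfl, rfl⟩

theorem Equivalent.symm {S T : Finset (Piece A B)} : Equivalent S T → Equivalent T S :=
  fun ⟨F, G, hF, hG, h⟩ => ⟨G, F, hG, hF, h.symm⟩

theorem Raw.ext_pieces {F G : Raw A B} (h : F.pieces = G.pieces) : F = G := by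
  cases F
  cases G
  cases h
  rfl

theorem Equivalent.trans {S T U : Finset (Piece A B)} :
    Equivalent S T → Equivalent T U → Equivalent S U := by
  rintro ⟨F, G, hF, hG, h⟩ ⟨G', H, hG', hH, h'⟩
  obtain rfl : G = G' := Raw.ext_pieces (hG.trans hG'.symm)
  exact ⟨F, H, hF, hH, h.trans h'⟩

theorem Equivalent.left {S T : Finset (Piece A B)} : Equivalent S T → PairwiseDisj S := by
  rintro ⟨F, G, rfl, rfl, h⟩
  exact F.disjoint

theorem Equivalent.right {S T : Finset (Piece A B)} (h : Equivalent S T) : PairwiseDisj T :=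
  h.symm.left

/-- Breaking splits the region of a piece by whether the point contains $e$, and keeps the germ.
Collapse removes a piece with empty region. Germs thus descend to classical maps. -/
theorem Step.germAt_iff {F G : Raw A B} (h : Step F G) (x : Point A) (f : A ⟶ B) :
    GermAt F.pieces x f ↔ GermAt G.pieces x f := by
  unfold GermAt
  cases h with
  | breaking R p hp e he hF hG =>
    rw [hF, hG]
    simp only [Finset.mem_insert, exists_eq_or_imp, Piece.at_inside he, Piece.at_outside he]
    tauto
  | collapse p hp h hF =>
    rw [hF]
    simp only [Finset.mem_insert, exists_eq_or_imp]
    have : ¬ p.At x f := fun h' => Piece.fst_eq_snd_iff.1 h x h'.1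
    tauto

/-- The classical map `c` is defined at `x`, with the germ of `f`. -/
def ClHom.At (c : ClHom A B) (x : Point A) (f : A ⟶ B) : Prop :=
  Quot.lift (fun F : Raw A B => GermAt F.pieces x f) (fun _ _ h => propext (h.germAt_iff x f)) c

theorem ClHom.at_mk {F : Raw A B} {x : Point A} {f : A ⟶ B} :
    (ClHom.mk F).At x f ↔ GermAt F.pieces x f := Iff.rfl

theorem Equivalent.germAt_iff {S T : Finset (Piece A B)} (h : Equivalent S T) (x : Point A)
    (f : A ⟶ B) : GermAt S x f ↔ GermAt T x f := by
  obtain ⟨F, G, rfl, rfl, h⟩ := h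
  rw [← ClHom.at_mk, h, ClHom.at_mk]

theorem Equivalent.definedAt_iff {S T : Finset (Piece A B)} (h : Equivalent S T) (x : Point A) :
    DefinedAt S x ↔ DefinedAt T x := by
  simp only [DiffRestr.definedAt_iff, h.germAt_iff]

/-! ### Empty pieces and disjoint remainders -/

open Classical

/-- Each new piece enters by one collapse read backwards. A piece already present needs no step,
because raw maps are sets. -/
theorem equivalent_union_of_empty {S : Finset (Piece A B)} (hS : PairwiseDisj S)
    (U : Finset (Piece A B)) (hU : ∀ p ∈ U, ∀ x, ¬ p.Reg x) : Equivalent S (S ∪ U) := by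
  have hdis : PairwiseDisj (S ∪ U) := by
    rw [pairwiseDisj_iff] at hS ⊢
    intro x p hp q hq hpx hqx
    rcases Finset.mem_union.1 hp with hp | hp
    · rcases Finset.mem_union.1 hq with hq | hq
      · exact hS x p hp q hq hpx hqx
      · exact absurd hqx (hU q hq x)
    · exact absurd hpx (hU p hp x)
  induction U using Finset.induction_on with
  | empty => simpa using Equivalent.refl hS
  | insert a U haU ih =>
    have hsub : S ∪ U ⊆ S ∪ insert a U := Finset.union_subset_union_right (Finset.subset_insert a U)
    have h := ih (fun p hp => hU p (Finset.mem_insert_of_mem hp)) (hdis.subset hsub)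
    rw [Finset.union_insert]
    by_cases ha : a ∈ S ∪ U
    · rwa [Finset.insert_eq_of_mem ha]
    · rw [Finset.union_insert] at hdis
      refine h.trans (Equivalent.symm ⟨⟨_, hdis⟩, ⟨_, hdis.subset (Finset.subset_insert _ _)⟩,
        rfl, rfl, Quot.sound (Step.collapse _ _ a ha ?_ rfl)⟩)
      exact Piece.fst_eq_snd_iff.2 (hU a (Finset.mem_insert_self a U))

theorem germAt_union {S T : Finset (Piece A B)} {x : Point A} {f : A ⟶ B} :
    GermAt (S ∪ T) x f ↔ GermAt S x f ∨ GermAt T x f := by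
  unfold GermAt
  simp only [Finset.mem_union, or_and_right, exists_or]

theorem pairwiseDisj_union {S T : Finset (Piece A B)} (hS : PairwiseDisj S) (hT : PairwiseDisj T)
    (h : ∀ x, DefinedAt S x → ¬ DefinedAt T x) : PairwiseDisj (S ∪ T) := by
  rw [pairwiseDisj_iff] at *
  intro x p hp q hq hpx hqx
  rcases Finset.mem_union.1 hp with hp | hp <;> rcases Finset.mem_union.1 hq with hq | hq
  · exact hS x p hp q hq hpx hqx
  · exact absurd ⟨q, hq, hqx⟩ (h x ⟨p, hp, hpx⟩)
  · exact absurd ⟨p, hp, hpx⟩ (h x ⟨q, hq, hqx⟩)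
  · exact hT x p hp q hq hpx hqx

/-- A rewriting step can be carried out in the presence of a disjoint remainder, so equivalences can
be assembled from disjoint parts. -/
theorem Step.equivalent_union {F G : Raw A B} (h : Step F G) {R : Finset (Piece A B)}
    (hR : PairwiseDisj R) (hd : ∀ x, DefinedAt F.pieces x → ¬ DefinedAt R x) :
    Equivalent (F.pieces ∪ R) (G.pieces ∪ R) := by
  have hFG : Equivalent F.pieces G.pieces := ⟨F, G, rfl, rfl, Quot.sound h⟩
  have hdF := pairwiseDisj_union F.disjoint hR hd
  have hdG := pairwiseDisj_union G.disjoint hR fun x hx => hd x ((hFG.definedAt_iff x).2 hx)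
  cases h with
  | breaking R' p hp e he hF hG =>
    -- The rule acts on a piece outside the rest of the set, so it does not apply when `p` also lies
    -- in `R`. Disjointness then makes the region of `p` empty, and the two sides differ only by
    -- empty pieces.
    by_cases hpR : p ∈ R
    · have hemp : ∀ x, ¬ p.Reg x := fun x hx =>
        hd x ⟨p, by rw [hF]; exact Finset.mem_insert_self _ _, hx⟩ ⟨p, hpR, hx⟩
      have h₁ : F.pieces ∪ R = R' ∪ R := by
        rw [hF, Finset.insert_union, Finset.insert_eq_of_mem (Finset.mem_union_right _ hpR)]
      have h₂ : G.pieces ∪ R = (R' ∪ R) ∪ {p.inside e, p.outside e he} := by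
        rw [hG]
        ext a
        simp only [Finset.mem_union, Finset.mem_insert, Finset.mem_singleton]
        tauto
      rw [h₁] at hdF ⊢
      rw [h₂]
      refine equivalent_union_of_empty hdF _ fun q hq x hx => ?_
      simp only [Finset.mem_insert, Finset.mem_singleton] at hq
      rcases hq with rfl | rfl
      · exact hemp x ((Piece.reg_inside he).1 hx).2
      · exact hemp x ((Piece.reg_outside he).1 hx).2
    · refine ⟨⟨_, hdF⟩, ⟨_, hdG⟩, rfl, rfl, Quot.sound (Step.breaking _ _ (R' ∪ R) p ?_ e he ?_ ?_)⟩
      · simp [hp, hpR]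
      · simp [hF]
      · simp [hG]
  | collapse p hp h hF =>
    have h₁ : F.pieces ∪ R = (G.pieces ∪ R) ∪ {p} := by
      rw [hF]
      ext a
      simp only [Finset.mem_union, Finset.mem_insert, Finset.mem_singleton]
      tauto
    rw [h₁]
    refine (equivalent_union_of_empty hdG _ fun q hq x hx => ?_).symm
    rw [Finset.mem_singleton] at hq
    subst hq
    exact Piece.fst_eq_snd_iff.1 h x hx

theorem Equivalent.union {S T R : Finset (Piece A B)} (h : Equivalent S T) (hR : PairwiseDisj R)
    (hd : ∀ x, DefinedAt S x → ¬ DefinedAt R x) : Equivalent (S ∪ R) (T ∪ R) := by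
  obtain ⟨F, G, rfl, rfl, h⟩ := h
  have key : ∀ F G : Raw A B, Relation.EqvGen Step F G →
      (∀ x, DefinedAt F.pieces x → ¬ DefinedAt R x) →
      Equivalent (F.pieces ∪ R) (G.pieces ∪ R) := by
    intro F G h
    have hFG : ∀ {F G : Raw A B}, Relation.EqvGen Step F G → Equivalent F.pieces G.pieces :=
      fun {F G} h => ⟨F, G, rfl, rfl, Quot.eqvGen_sound h⟩
    induction h with
    | rel F G h => exact h.equivalent_union hR
    | refl F => exact fun hd => Equivalent.refl (pairwiseDisj_union F.disjoint hR hd)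
    | symm F G h ih =>
      exact fun hd => (ih fun x hx => hd x (((hFG h).definedAt_iff x).1 hx)).symm
    | trans F G H h₁ h₂ ih₁ ih₂ =>
      exact fun hd => (ih₁ hd).trans (ih₂ fun x hx => hd x (((hFG h₁).definedAt_iff x).2 hx))
  exact key F G (Quot.eqvGen_exact h) hd

/-! ### Cutting along a restriction idempotent -/

theorem germAt_image_inside {S : Finset (Piece A B)} {e : A ⟶ A} (he : rest e = e) {x : Point A}
    {f : A ⟶ B} : GermAt (S.image fun p => p.inside e) x f ↔ x.mem e ∧ GermAt S x f := by
  unfold GermAt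
  simp only [Finset.exists_mem_image, Piece.at_inside he]
  tauto

theorem germAt_image_outside {S : Finset (Piece A B)} {e : A ⟶ A} (he : rest e = e) {x : Point A}
    {f : A ⟶ B} : GermAt (S.image fun p => p.outside e he) x f ↔ ¬ x.mem e ∧ GermAt S x f := by
  unfold GermAt
  simp only [Finset.exists_mem_image, Piece.at_outside he]
  tauto

theorem PairwiseDisj.image {A' B' : X} {S : Finset (Piece A B)} (hS : PairwiseDisj S)
    {φ : Piece A B → Piece A' B'} (y : Point A' → Point A)
    (hφ : ∀ p x, (φ p).Reg x → p.Reg (y x)) : PairwiseDisj (S.image φ) := by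
  rw [pairwiseDisj_iff] at *
  simp only [Finset.forall_mem_image]
  intro x p hp q hq hpx hqx
  rw [hS (y x) p hp q hq (hφ _ _ hpx) (hφ _ _ hqx)]

/-- The point `z` may depend on the first piece: in a composite, the second piece is tested at the
point pushed along the first. Disjointness of `S` fixes the first piece before disjointness of `T`
is used. -/
theorem PairwiseDisj.image₂ {A' B' E F : X} {S : Finset (Piece A B)} {T : Finset (Piece A' B')}
    (hS : PairwiseDisj S) (hT : PairwiseDisj T) {φ : Piece A B → Piece A' B' → Piece E F}
    (y : Point E → Point A) (z : Piece A B → Point E → Point A')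
    (hφ : ∀ p q x, (φ p q).Reg x → p.Reg (y x) ∧ q.Reg (z p x)) :
    PairwiseDisj (Finset.image₂ φ S T) := by
  rw [pairwiseDisj_iff] at *
  simp only [Finset.forall_mem_image₂]
  intro x p hp q hq p' hp' q' hq' hx hx'
  obtain rfl := hS (y x) p hp p' hp' (hφ _ _ _ hx).1 (hφ _ _ _ hx').1
  rw [hT (z p x) q hq q' hq' (hφ _ _ _ hx).2 (hφ _ _ _ hx').2]

theorem PairwiseDisj.inside {S : Finset (Piece A B)} (hS : PairwiseDisj S) {e : A ⟶ A}
    (he : rest e = e) : PairwiseDisj (S.image fun p => p.inside e) :=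
  hS.image id fun _ _ h => ((Piece.reg_inside he).1 h).2

theorem PairwiseDisj.outside {S : Finset (Piece A B)} (hS : PairwiseDisj S) {e : A ⟶ A}
    (he : rest e = e) : PairwiseDisj (S.image fun p => p.outside e he) :=
  hS.image id fun _ _ h => ((Piece.reg_outside he).1 h).2

theorem definedAt_image_inside {S : Finset (Piece A B)} {e : A ⟶ A} (he : rest e = e)
    {x : Point A} : DefinedAt (S.image fun p => p.inside e) x ↔ x.mem e ∧ DefinedAt S x := by
  simp only [definedAt_iff, germAt_image_inside he, exists_and_left]

theorem definedAt_image_outside {S : Finset (Piece A B)} {e : A ⟶ A} (he : rest e = e)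
    {x : Point A} :
    DefinedAt (S.image fun p => p.outside e he) x ↔ ¬ x.mem e ∧ DefinedAt S x := by
  simp only [definedAt_iff, germAt_image_outside he, exists_and_left]

theorem pairwiseDisj_singleton (p : Piece A B) : PairwiseDisj {p} := by
  simp [PairwiseDisj]

theorem equivalent_singleton_cut (p : Piece A B) {e : A ⟶ A} (he : rest e = e) :
    Equivalent {p} {p.inside e, p.outside e he} := by
  have hd : PairwiseDisj {p.inside e, p.outside e he} := by
    have := pairwiseDisj_union ((pairwiseDisj_singleton p).inside he)
      ((pairwiseDisj_singleton p).outside he) fun x h₁ h₂ =>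
        ((definedAt_image_outside he).1 h₂).1 ((definedAt_image_inside he).1 h₁).1
    simpa only [Finset.image_singleton, Finset.singleton_union] using this
  exact ⟨⟨{p}, pairwiseDisj_singleton p⟩, ⟨_, hd⟩, rfl, rfl,
    Quot.sound (Step.breaking _ _ ∅ p (by simp) e he (by simp) (by simp))⟩

theorem equivalent_cut {S : Finset (Piece A B)} (hS : PairwiseDisj S) {e : A ⟶ A}
    (he : rest e = e) :
    Equivalent S ((S.image fun p => p.inside e) ∪ S.image fun p => p.outside e he) := by
  induction S using Finset.induction_on with
  | empty => simpa using Equivalent.refl hS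
  | insert p S hp ih =>
    have hS' := hS.subset (Finset.subset_insert p S)
    have hd : ∀ x, p.Reg x → ¬ DefinedAt S x := by
      rintro x hx ⟨q, hq, hqx⟩
      have := pairwiseDisj_iff.1 hS x p (by simp) q (by simp [hq]) hx hqx
      exact hp (this ▸ hq)
    have h₁ := (ih hS').union (pairwiseDisj_singleton p) fun x hx => by
      rintro ⟨q, hq, hqx⟩
      rw [Finset.mem_singleton] at hq
      exact hd x (hq ▸ hqx) hx
    have h₂ := (equivalent_singleton_cut p he).union (ih hS').right fun x hx hx' => by
      obtain ⟨q, hq, hqx⟩ := hx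
      rw [Finset.mem_singleton] at hq
      exact hd x (hq ▸ hqx) (((ih hS').definedAt_iff x).2 hx')
    have e₁ : insert p S = S ∪ {p} := by rw [Finset.union_comm, Finset.singleton_union]
    rw [Finset.union_comm] at h₂
    have h₃ := h₁.trans h₂
    rw [Finset.image_insert, Finset.image_insert, e₁]
    convert h₃ using 1
    ext a
    simp only [Finset.mem_union, Finset.mem_insert, Finset.mem_singleton]
    tauto

/-- Equivalence is local: it can be checked separately inside and outside $e$, because the two
halves have disjoint regions and can be replaced one after the other. -/
theorem equivalent_of_cut {S T : Finset (Piece A B)} (hS : PairwiseDisj S) (hT : PairwiseDisj T)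
    {e : A ⟶ A} (he : rest e = e)
    (h₁ : Equivalent (S.image fun p => p.inside e) (T.image fun p => p.inside e))
    (h₂ : Equivalent (S.image fun p => p.outside e he) (T.image fun p => p.outside e he)) :
    Equivalent S T := by
  have h₃ := h₁.union (hS.outside he) fun x h h' =>
    ((definedAt_image_outside he).1 h').1 ((definedAt_image_inside he).1 h).1
  have h₄ := h₂.union (hT.inside he) fun x h h' =>
    ((definedAt_image_outside he).1 h).1 ((definedAt_image_inside he).1 h').1
  rw [Finset.union_comm, Finset.union_comm (T.image fun p => p.outside e he)] at h₄
  exact (equivalent_cut hS he).trans (h₃.trans (h₄.trans (equivalent_cut hT he).symm))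

theorem equivalent_insert_of_empty {S : Finset (Piece A B)} (hS : PairwiseDisj S) {p : Piece A B}
    (hp : ∀ x, ¬ p.Reg x) : Equivalent S (insert p S) := by
  have := equivalent_union_of_empty hS {p} (by simpa using hp)
  rwa [Finset.union_comm, Finset.singleton_union] at this

/-! ### Germs determine the classical map -/

theorem empty_comp {E : X} (f : B ⟶ E) : empty A B ≫ f = empty A E :=
  Point.eq_of_le_of_has (le_self _) (empty_le _) fun _ =>
    ⟨fun h => absurd h.left Point.not_has_empty, fun h => absurd h Point.not_has_empty⟩

/-- Germs that agree on the whole region of a piece agree on one idempotent covering it. -/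
theorem Piece.exists_idem_of_agree (p : Piece A B) (g : A ⟶ B)
    (h : ∀ x, p.Reg x → x.Agree p.fst g) :
    ∃ e : A ⟶ A, rest e = e ∧ e ≫ p.fst = e ≫ g ∧ ∀ x, p.Reg x → x.mem e := by
  by_contra hc
  -- Compactness: `I` holds for `k` if one idempotent of agreement covers the part of `k` outside
  -- `p.snd`. This is an ideal, by `join_comp`. If it misses the domain of `p.fst`, a point of that
  -- domain avoids it. That point also avoids `p.snd`, for which nothing has to be covered, so it
  -- lies in the region of `p`. The idempotent of agreement given there is itself in `I`, a
  -- contradiction.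
  let I : (A ⟶ A) → Prop := fun k => ∃ e : A ⟶ A, rest e = e ∧ e ≫ p.fst = e ≫ g ∧
    ∀ x : Point A, x.mem k → ¬ x.Has p.snd → x.mem e
  obtain ⟨x, hx, hI⟩ : ∃ x : Point A, x.mem (rest p.fst) ∧ ∀ e, rest e = e → I e → ¬ x.mem e := by
    refine Point.exists_point I ?_ ?_ ?_ (rest_rest p.fst) ?_
    · exact ⟨empty A A, rest_empty, by rw [empty_comp, empty_comp], fun _ h _ => h⟩
    · rintro e e' he he' hle ⟨a, ha, haeq, hcov⟩
      refine ⟨a, ha, haeq, fun x hx => hcov x ?_⟩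
      rw [← Point.has_endo] at hx ⊢
      exact hx.mono hle
    · rintro e e' hc' he he' ⟨a, ha, haeq, hcov⟩ ⟨a', ha', haeq', hcov'⟩
      refine ⟨join a a' (compat_idem ha ha'), rest_join_idem ha ha' _,
        Point.join_comp _ _ _ _ haeq haeq', fun x hx hs => ?_⟩
      rw [x.mem_join] at hx ⊢
      exact hx.imp (fun h => hcov x h hs) fun h => hcov' x h hs
    · rintro ⟨e, he, heq, hcov⟩
      exact hc ⟨e, he, heq, fun x hx => hcov x hx.1 hx.2⟩
  have hreg : p.Reg x := by
    refine ⟨hx, fun h' => ?_⟩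
    exact hI (rest p.snd) (rest_rest _) ⟨empty A A, rest_empty, by rw [empty_comp, empty_comp],
      fun y hy hy' => absurd hy hy'⟩ h'
  obtain ⟨e, he, hxe, heq⟩ := h x hreg
  exact hI e he ⟨e, he, heq, fun y hy _ => hy⟩ hxe

/-- One idempotent $e$ covers the common region and makes the first components agree. The parts
outside $e$ are empty and can be dropped, and the parts inside $e$ are literally equal. -/
theorem equivalent_singleton {p q : Piece A B}
    (h : ∀ x f, p.At x f ↔ q.At x f) : Equivalent {p} {q} := by
  have hreg : ∀ x, p.Reg x ↔ q.Reg x := fun x =>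
    ⟨fun hx => ((h x _).1 hx.at).1, fun hx => ((h x _).2 hx.at).1⟩
  obtain ⟨e, he, heq, hcov⟩ := p.exists_idem_of_agree q.fst fun x hx =>
    ((h x _).2 ((hreg x).1 hx).at).2
  have key : ∀ r : Piece A B, (∀ x, r.Reg x → x.mem e) → Equivalent {r} {r.inside e} := by
    intro r hr
    refine (equivalent_singleton_cut r he).trans ?_
    rw [Finset.pair_comm]
    refine (equivalent_insert_of_empty (pairwiseDisj_singleton _) fun x hx => ?_).symm
    rw [Piece.reg_outside he] at hx
    exact hx.1 (hr x hx.2)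
  have heq' : p.inside e = q.inside e := by
    -- The second components lie below the common map $e f$, and equal regions force them to have
    -- equal domains.
    refine Piece.ext heq ?_
    refine Point.eq_of_le_of_has (k := e ≫ p.fst) (comp_le_comp (le_self e) p.le) ?_ fun x => ?_
    · rw [heq]
      exact comp_le_comp (le_self e) q.le
    · have hx := hreg x
      have h₁ : x.Has (e ≫ p.fst) ↔ x.Has (e ≫ q.fst) := by rw [heq]
      have hp : x.Has p.snd → x.Has p.fst := fun h => h.mono p.le
      have hq : x.Has q.snd → x.Has q.fst := fun h => h.mono q.le
      change x.Has (e ≫ p.snd) ↔ x.Has (e ≫ q.snd)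
      unfold Piece.Reg at hx
      simp only [Point.has_idem_comp he] at h₁ ⊢
      tauto
  have h₁ := key p hcov
  rw [heq'] at h₁
  exact h₁.trans (key q fun x hx => hcov x ((hreg x).2 hx)).symm

/-- This reduces the first set to a single piece. The predicate `P`, stable under cutting, records
what is known of the second set, so that the reduction can be applied once to each side. The
induction is on a bound for the number of pieces, since taking images may identify pieces. -/
theorem equivalent_of_germAt_of_singleton (P : Finset (Piece A B) → Prop)
    (hin : ∀ T e, rest e = e → P T → P (T.image fun p => p.inside e))
    (hout : ∀ T e (he : rest e = e), P T → P (T.image fun p => p.outside e he))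
    (hP : ∀ p T, P T → PairwiseDisj T → (∀ x f, GermAt {p} x f ↔ GermAt T x f) →
      Equivalent {p} T) (n : ℕ) :
    ∀ S T : Finset (Piece A B), S.card ≤ n → PairwiseDisj S → PairwiseDisj T → P T →
      (∀ x f, GermAt S x f ↔ GermAt T x f) → Equivalent S T := by
  have hempty : ∀ T : Finset (Piece A B), PairwiseDisj T →
      (∀ x f, GermAt (∅ : Finset (Piece A B)) x f ↔ GermAt T x f) →
      Equivalent ∅ T := by
    intro T hT h
    have := equivalent_union_of_empty (S := ∅) (hT.subset (Finset.empty_subset T)) T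
      fun p hp x hx => by
        obtain ⟨q, hq, _⟩ := (h x p.fst).2 ⟨p, hp, hx.at⟩
        exact absurd hq (Finset.notMem_empty q)
    rwa [Finset.empty_union] at this
  induction n with
  | zero =>
    intro S T hc _ hT _ h
    obtain rfl : S = ∅ := Finset.card_eq_zero.1 (Nat.le_zero.1 hc)
    exact hempty T hT h
  | succ n ih =>
    intro S T hc hS hT hPT h
    obtain rfl | ⟨p, hp⟩ := S.eq_empty_or_nonempty
    · exact hempty T hT h
    obtain ⟨R, hpR, rfl⟩ : ∃ R, p ∉ R ∧ insert p R = S :=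
      ⟨S.erase p, Finset.notMem_erase p S, Finset.insert_erase hp⟩
    have hR := hS.subset (Finset.subset_insert p R)
    have hcR : R.card ≤ n := by
      rw [Finset.card_insert_of_notMem hpR] at hc
      omega
    have step : ∀ (φ : Piece A B → Piece A B) (T' : Finset (Piece A B)), (∀ x, ¬ (φ p).Reg x) →
        PairwiseDisj (R.image φ) → PairwiseDisj T' → P T' →
        (∀ x f, GermAt ((insert p R).image φ) x f ↔ GermAt T' x f) →
        Equivalent ((insert p R).image φ) T' := by
      intro φ T' hφ hRφ hT' hPT' h'
      have h₁ := equivalent_insert_of_empty hRφ hφ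
      rw [← Finset.image_insert] at h₁
      exact h₁.symm.trans (ih _ _ (Finset.card_image_le.trans hcR) hRφ hT' hPT' fun x f =>
        (h₁.germAt_iff x f).trans (h' x f))
    have he := rest_rest p.fst
    have he' := rest_rest p.snd
    -- Cutting along the domains of `p.fst` and `p.snd` leaves three zones. Outside the first
    -- domain, or inside both, `p` becomes empty and the induction hypothesis applies to `R`. Inside
    -- the first and outside the second lies exactly the region of `p`; there the other pieces are
    -- empty, and the single-piece case `hP` applies.
    refine equivalent_of_cut hS hT he ?_ (step _ _ (fun x hx => ?_) (hR.outside he) (hT.outside he)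
      (hout _ _ he hPT) fun x f => ?_)
    · refine equivalent_of_cut (hS.inside he) (hT.inside he) he' ?_ ?_
      · rw [Finset.image_image]
        refine step _ _ (fun x hx => ?_) ?_ ((hT.inside he).inside he')
          (hin _ _ he' (hin _ _ he hPT)) fun x f => ?_
        · have := (Piece.reg_inside he').1 hx
          exact ((Piece.reg_inside he).1 this.2).2.2 this.1
        · rw [← Finset.image_image]
          exact (hR.inside he).inside he'
        · rw [← Finset.image_image]
          simp only [germAt_image_inside he, germAt_image_inside he', h]
      · have h₁ : Equivalent {(p.inside (rest p.fst)).outside (rest p.snd) he'}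
            (((insert p R).image fun p' => p'.inside (rest p.fst)).image
              fun p' => p'.outside (rest p.snd) he') := by
          rw [Finset.image_insert, Finset.image_insert]
          refine equivalent_union_of_empty (pairwiseDisj_singleton _) _ fun q hq x hx => ?_
          have hx' : DefinedAt _ x := ⟨q, hq, hx⟩
          rw [definedAt_image_outside he', definedAt_image_inside he] at hx'
          obtain ⟨h₂, h₃, r, hr, hrx⟩ := hx'
          have := pairwiseDisj_iff.1 hS x p (by simp) r (by simp [hr]) ⟨h₃, h₂⟩ hrx
          exact hpR (this ▸ hr)
        refine h₁.symm.trans (hP _ _ (hout _ _ he' (hin _ _ he hPT)) ((hT.inside he).outside he')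
          fun x f => (h₁.germAt_iff x f).trans ?_)
        simp only [germAt_image_inside he, germAt_image_outside he', h]
    · rw [Piece.reg_outside he] at hx
      exact hx.1 hx.2.1
    · simp only [germAt_image_outside he, h]

/-- Sets of pairwise disjoint pieces with the same germs represent the same classical map. -/
theorem equivalent_of_germAt {S T : Finset (Piece A B)} (hS : PairwiseDisj S)
    (hT : PairwiseDisj T) (h : ∀ x f, GermAt S x f ↔ GermAt T x f) : Equivalent S T := by
  refine equivalent_of_germAt_of_singleton (fun _ => True) (fun _ _ _ _ => trivial)
    (fun _ _ _ _ => trivial) (fun p T _ hT h => ?_) _ S T le_rfl hS hT trivial h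
  -- The second reduction exchanges the roles: `T` is now reduced to one piece, and `P` keeps track
  -- of the other side being a singleton.
  refine (equivalent_of_germAt_of_singleton (fun T => ∃ q, T = {q}) ?_ ?_ ?_ _ T {p} le_rfl hT
    (pairwiseDisj_singleton p) ⟨p, rfl⟩ fun x f => (h x f).symm).symm
  · rintro _ e _ ⟨q, rfl⟩
    exact ⟨_, Finset.image_singleton _ _⟩
  · rintro _ e _ ⟨q, rfl⟩
    exact ⟨_, Finset.image_singleton _ _⟩
  · rintro p _ ⟨q, rfl⟩ _ h
    refine equivalent_singleton fun x f => ?_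
    simpa [GermAt] using h x f

/-- A classical map is determined by its germs. -/
theorem ClHom.ext_germ {c d : ClHom A B} (h : ∀ x f, c.At x f ↔ d.At x f) : c = d := by
  induction c using Quot.ind with
  | mk F =>
    induction d using Quot.ind with
    | mk G =>
      obtain ⟨F', G', hF, hG, h⟩ := equivalent_of_germAt F.disjoint G.disjoint h
      rwa [Raw.ext_pieces hF, Raw.ext_pieces hG] at h

end Germs

section Operations

variable {X : Type u} [Category.{v} X] [RestrictionOp X] [ProductOp X] [AdditiveOp X]
  [DifferentialOp X] [DifferentialJoinRestrictionCategory X] {Z A B E : X}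

/-! ### Points and the differential structure -/

theorem pair_π₀_π₁ (A B : X) : pair (π₀ A B) (π₁ A B) = 𝟙 (prod A B) := by
  symm
  refine CartesianRestrictionCategory.pair_unique _ _ _ ?_ ?_ ?_
  · rw [rest_id]
  · rw [rest_id]
  · rw [rest_id, CartesianRestrictionCategory.π₀_total, CartesianRestrictionCategory.π₁_total,
      Category.comp_id]

theorem eq_pair (f : Z ⟶ prod A B) : f = pair (f ≫ π₀ A B) (f ≫ π₁ A B) := by
  rw [← comp_pair, pair_π₀_π₁, Category.comp_id]

/-- By `DR5` and `DR8`, $D[\overline e f]=\langle(1\times\overline e)\pi_0,\pi_1\overline e\rangle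
D[f]=(1\times\overline e)D[f]$, and $1\times\overline e=\overline{D[e]}$ by `DR9`. -/
theorem rest_D_comp_D (e : A ⟶ E) (f : A ⟶ B) : rest (D e) ≫ D f = D (rest e ≫ f) := by
  have key : prodMap (𝟙 A) (rest e) ≫ π₁ A A = π₁ A A ≫ rest e := by
    unfold prodMap
    rw [CartesianRestrictionCategory.pair_π₁, CartesianRestrictionCategory.rest_pair,
      Category.comp_id, CartesianRestrictionCategory.π₀_total, Category.id_comp,
      RestrictionCategory.R1]
  rw [DifferentialRestrictionCategory.DR5, DifferentialRestrictionCategory.DR8, ← key,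
    ← comp_pair, pair_π₀_π₁, Category.comp_id, DifferentialRestrictionCategory.DR9]

namespace Point

variable {x : Point Z}

@[simp]
theorem has_pair {f : Z ⟶ A} {g : Z ⟶ B} : x.Has (pair f g) ↔ x.Has f ∧ x.Has g := by
  rw [← has_rest (f := pair f g), CartesianRestrictionCategory.rest_pair, has_rest_comp, has_rest]

@[simp]
theorem has_add {f g : Z ⟶ A} : x.Has (add f g) ↔ x.Has f ∧ x.Has g := by
  rw [← has_rest (f := add f g), LeftAdditiveRestrictionCategory.rest_add, has_rest_comp, has_rest]

theorem Has.π₀ {f : prod A B ⟶ E} {x : Point (prod A B)} (h : x.Has f) : x.Has (π₀ A B) :=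
  h.total (CartesianRestrictionCategory.π₀_total A B)

theorem Has.bang {f : Z ⟶ A} (h : x.Has f) : x.Has (bang Z) :=
  h.total (CartesianRestrictionCategory.bang_total Z)

theorem Has.zero {f : Z ⟶ A} (h : x.Has f) : x.Has (zero Z B) :=
  h.total (LeftAdditiveRestrictionCategory.rest_zero Z B)

theorem Has.id {f : Z ⟶ A} (h : x.Has f) : x.Has (𝟙 Z) := h.total (rest_id Z)

theorem has_D {f : A ⟶ B} {x : Point (prod A A)} : x.Has (D f) ↔ x.Has (ProductOp.π₁ A A ≫ f) := by
  rw [← has_rest, DifferentialRestrictionCategory.DR9, prodMap, has_pair, Category.comp_id]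
  have : x.Has (ProductOp.π₁ A A ≫ rest f) ↔ x.Has (ProductOp.π₁ A A ≫ f) := by
    unfold Has
    rw [rest_comp_rest]
  rw [this]
  exact ⟨fun h => h.2, fun h => ⟨h.π₀, h⟩⟩

theorem Agree.exists_common {f f' : Z ⟶ A} {g g' : Z ⟶ B} (hf : x.Agree f f')
    (hg : x.Agree g g') :
    ∃ e : Z ⟶ Z, rest e = e ∧ x.mem e ∧ e ≫ f = e ≫ f' ∧ e ≫ g = e ≫ g' := by
  obtain ⟨e, he, hx, hf⟩ := hf
  obtain ⟨e', he', hx', hg⟩ := hg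
  refine ⟨e ≫ e', by rw [rest_idem_comp he, he'], ?_, ?_, ?_⟩
  · rw [← he, ← he', x.mem_comp]
    exact ⟨hx, hx'⟩
  · rw [idem_comm he he', Category.assoc, Category.assoc, hf]
  · rw [Category.assoc, Category.assoc, hg]

theorem Agree.pair {f f' : Z ⟶ A} {g g' : Z ⟶ B} (hf : x.Agree f f') (hg : x.Agree g g') :
    x.Agree (pair f g) (pair f' g') := by
  obtain ⟨e, he, hx, hf, hg⟩ := hf.exists_common hg
  exact ⟨e, he, hx, by rw [comp_pair, comp_pair, hf, hg]⟩

theorem Agree.add {f f' g g' : Z ⟶ A} (hf : x.Agree f f') (hg : x.Agree g g') :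
    x.Agree (add f g) (add f' g') := by
  obtain ⟨e, he, hx, hf, hg⟩ := hf.exists_common hg
  exact ⟨e, he, hx, by
    rw [LeftAdditiveRestrictionCategory.comp_add, LeftAdditiveRestrictionCategory.comp_add, hf, hg]⟩

/-- Differentiation is local in the base point, the second coordinate: if $f$ and $f'$ agree on $e$,
then $D[f]$ and $D[f']$ agree on $\overline{D[e]}$. -/
theorem Agree.D {f f' : A ⟶ B} {x : Point (prod A A)}
    (h : (x.push (ProductOp.π₁ A A)).Agree f f') : x.Agree (D f) (D f') := by
  obtain ⟨e, he, hx, h⟩ := h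
  refine agree_of_rest (h := DifferentialOp.D e) (has_D.2 hx) ?_
  rw [rest_D_comp_D, rest_D_comp_D, he, h]

theorem Has.agree_pair_π₀ {f : Z ⟶ A} {g : Z ⟶ B} (hg : x.Has g) :
    x.Agree (ProductOp.pair f g ≫ ProductOp.π₀ A B) f := by
  rw [CartesianRestrictionCategory.pair_π₀, CartesianRestrictionCategory.rest_pair,
    RestrictionCategory.R2, Category.assoc, RestrictionCategory.R1]
  exact hg.agree_rest_comp f

theorem Has.agree_pair_π₁ {f : Z ⟶ A} {g : Z ⟶ B} (hf : x.Has f) :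
    x.Agree (ProductOp.pair f g ≫ ProductOp.π₁ A B) g := by
  rw [CartesianRestrictionCategory.pair_π₁, CartesianRestrictionCategory.rest_pair,
    Category.assoc, RestrictionCategory.R1]
  exact hf.agree_rest_comp g

theorem Has.agree_comp_bang {f : Z ⟶ A} (hf : x.Has f) :
    x.Agree (f ≫ ProductOp.bang A) (ProductOp.bang Z) := by
  refine agree_of_rest hf ?_
  rw [← Category.assoc, RestrictionCategory.R1]
  have h := CartesianRestrictionCategory.comp_bang f
  unfold Le at h
  rw [← rest_comp_rest, CartesianRestrictionCategory.bang_total, Category.comp_id] at h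
  exact h.symm

theorem Has.agree_comp_zero {f : Z ⟶ A} (hf : x.Has f) :
    x.Agree (f ≫ AdditiveOp.zero A B) (AdditiveOp.zero Z B) := by
  rw [LeftAdditiveRestrictionCategory.comp_zero]
  exact hf.agree_rest_comp _

end Point

/-! ### Regions of the operations on pieces -/

namespace Piece

/-- Where $f'$ is defined it has the germ of $f$, so $f'g$ and $fg$ are defined together. This lets
the region of a composite be expressed through $f$ alone. -/
theorem has_snd_comp {p : Piece A B} {x : Point A} {g : B ⟶ E} :
    x.Has (p.snd ≫ g) ↔ x.Has p.snd ∧ x.Has (p.fst ≫ g) := by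
  constructor
  · exact fun h => ⟨h.left, ((h.left.agree_of_le p.le).comp_right g).has h⟩
  · exact fun h => ((h.1.agree_of_le p.le).symm.comp_right g).has h.2

theorem reg_comp {p : Piece A B} {q : Piece B E} {x : Point A} :
    (p.comp q).Reg x ↔ p.Reg x ∧ q.Reg (x.push p.fst) := by
  have h : x.Has (p.fst ≫ q.fst) → x.Has p.fst := fun h => h.left
  unfold comp
  rw [reg_mkJoin, has_snd_comp]
  unfold Reg
  rw [Point.has_push, Point.has_push]
  tauto

theorem reg_restr {p : Piece A B} {x : Point A} : p.restr.Reg x ↔ p.Reg x := by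
  unfold Reg restr
  rw [Point.has_rest, Point.has_rest]

theorem reg_pair {p : Piece Z A} {q : Piece Z B} {x : Point Z} :
    (p.pair q).Reg x ↔ p.Reg x ∧ q.Reg x := by
  unfold pair
  rw [reg_mkJoin]
  unfold Reg
  simp only [Point.has_pair]
  tauto

theorem reg_add {p q : Piece A B} {x : Point A} :
    (p.add q).Reg x ↔ p.Reg x ∧ q.Reg x := by
  unfold add
  rw [reg_mkJoin]
  unfold Reg
  simp only [Point.has_add]
  tauto

theorem reg_D {p : Piece A B} {x : Point (prod A A)} :
    p.D.Reg x ↔ p.Reg (x.push (π₁ A A)) := by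
  unfold Reg D
  rw [Point.has_D, Point.has_D, Point.has_push, Point.has_push]

end Piece

/-! ### Operations on classical maps -/

namespace ClHom

open Classical

/-- A raw classical map representing `c`. -/
noncomputable def out (c : ClHom A B) : Raw A B := Quot.out c

theorem mk_out (c : ClHom A B) : mk c.out = c := Quot.out_eq c

theorem at_out {c : ClHom A B} {x : Point A} {f : A ⟶ B} :
    GermAt c.out.pieces x f ↔ c.At x f := by
  rw [← at_mk, mk_out]

theorem At.has {c : ClHom A B} {x : Point A} {f : A ⟶ B} (h : c.At x f) : x.Has f := by
  obtain ⟨p, _, hp⟩ := at_out.2 h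
  exact hp.2.has hp.1.1

theorem At.congr {c : ClHom A B} {x : Point A} {f g : A ⟶ B} (h : c.At x f) (hfg : x.Agree f g) :
    c.At x g := by
  obtain ⟨p, hc, hp⟩ := at_out.2 h
  exact at_out.1 ⟨p, hc, hp.1, hp.2.trans hfg⟩

theorem At.agree {c : ClHom A B} {x : Point A} {f g : A ⟶ B} (h : c.At x f) (h' : c.At x g) :
    x.Agree f g := by
  obtain ⟨p, hc, hp⟩ := at_out.2 h
  obtain ⟨q, hc', hq⟩ := at_out.2 h'
  obtain rfl := pairwiseDisj_iff.1 c.out.disjoint x p hc q hc' hp.1 hq.1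
  exact hp.2.symm.trans hq.2

/-- The classical map `c` is defined at `x`. -/
def Def (c : ClHom A B) (x : Point A) : Prop := ∃ f, c.At x f

theorem At.def {c : ClHom A B} {x : Point A} {f : A ⟶ B} (h : c.At x f) : c.Def x := ⟨f, h⟩

theorem Def.mem_id {c : ClHom A B} {x : Point A} (h : c.Def x) : x.Has (𝟙 A) := by
  obtain ⟨f, hf⟩ := h
  exact hf.has.id

/-- Two classical maps are equal if they have a common germ wherever one of them is defined. -/
theorem ext_def {c d : ClHom A B}
    (h : ∀ x, c.Def x ∨ d.Def x → ∃ f g, c.At x f ∧ d.At x g ∧ x.Agree f g) : c = d := by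
  refine ext_germ fun x k => ⟨fun hk => ?_, fun hk => ?_⟩
  · obtain ⟨f, g, hf, hg, hfg⟩ := h x (.inl ⟨k, hk⟩)
    exact hg.congr (hfg.symm.trans (hf.agree hk))
  · obtain ⟨f, g, hf, hg, hfg⟩ := h x (.inr ⟨k, hk⟩)
    exact hf.congr (hfg.trans (hg.agree hk))

/-- Composition of classical maps. -/
noncomputable def comp (a : ClHom A B) (b : ClHom B E) : ClHom A E :=
  mk ⟨Finset.image₂ Piece.comp a.out.pieces b.out.pieces,
    PairwiseDisj.image₂ a.out.disjoint b.out.disjoint id (fun p x => x.push p.fst)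
      fun _ _ _ => Piece.reg_comp.1⟩

/-- Restriction of classical maps. -/
noncomputable def restr (a : ClHom A B) : ClHom A A :=
  mk ⟨a.out.pieces.image Piece.restr,
    PairwiseDisj.image a.out.disjoint id fun _ _ => Piece.reg_restr.1⟩

/-- Pairing of classical maps. -/
noncomputable def pair (a : ClHom Z A) (b : ClHom Z B) : ClHom Z (prod A B) :=
  mk ⟨Finset.image₂ Piece.pair a.out.pieces b.out.pieces,
    PairwiseDisj.image₂ a.out.disjoint b.out.disjoint id (fun _ => id)
      fun _ _ _ => Piece.reg_pair.1⟩

/-- Addition of classical maps. -/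
noncomputable def add (a b : ClHom A B) : ClHom A B :=
  mk ⟨Finset.image₂ Piece.add a.out.pieces b.out.pieces,
    PairwiseDisj.image₂ a.out.disjoint b.out.disjoint id (fun _ => id)
      fun _ _ _ => Piece.reg_add.1⟩

/-- Differential of classical maps. -/
noncomputable def diff (a : ClHom A B) : ClHom (prod A A) B :=
  mk ⟨a.out.pieces.image Piece.D,
    PairwiseDisj.image a.out.disjoint (fun x => x.push (π₁ A A)) fun _ _ => Piece.reg_D.1⟩

/-- Here and in the analogues for the other operations, the right-hand side involves only the germs
of the arguments. This is why the formulas do not depend on representatives. -/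
theorem germAt_comp {S : Finset (Piece A B)} {T : Finset (Piece B E)} {x : Point A} {h : A ⟶ E} :
    GermAt (Finset.image₂ Piece.comp S T) x h ↔
      ∃ f g, GermAt S x f ∧ GermAt T (x.push f) g ∧ x.Agree (f ≫ g) h := by
  simp only [GermAt, Finset.exists_mem_image₂]
  constructor
  · rintro ⟨p, hp, q, hq, hr, ha⟩
    have hr := Piece.reg_comp.1 hr
    exact ⟨p.fst, q.fst, ⟨p, hp, hr.1.at⟩, ⟨q, hq, hr.2.at⟩, ha⟩
  · rintro ⟨f, g, ⟨p, hp, hpr, hpf⟩, ⟨q, hq, hqr, hqg⟩, ha⟩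
    rw [← hpf.push_eq] at hqr hqg
    exact ⟨p, hp, q, hq, Piece.reg_comp.2 ⟨hpr, hqr⟩, (hpf.comp hqg).trans ha⟩

theorem germAt_restr {S : Finset (Piece A B)} {x : Point A} {h : A ⟶ A} :
    GermAt (S.image Piece.restr) x h ↔ ∃ f, GermAt S x f ∧ x.Agree (rest f) h := by
  simp only [GermAt, Finset.exists_mem_image]
  constructor
  · rintro ⟨p, hp, hr, ha⟩
    exact ⟨p.fst, ⟨p, hp, (Piece.reg_restr.1 hr).at⟩, ha⟩
  · rintro ⟨f, ⟨p, hp, hpr, hpf⟩, ha⟩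
    exact ⟨p, hp, Piece.reg_restr.2 hpr, hpf.rest_congr.trans ha⟩

theorem germAt_pair {S : Finset (Piece Z A)} {T : Finset (Piece Z B)} {x : Point Z}
    {h : Z ⟶ prod A B} : GermAt (Finset.image₂ Piece.pair S T) x h ↔
      ∃ f g, GermAt S x f ∧ GermAt T x g ∧ x.Agree (ProductOp.pair f g) h := by
  simp only [GermAt, Finset.exists_mem_image₂]
  constructor
  · rintro ⟨p, hp, q, hq, hr, ha⟩
    have hr := Piece.reg_pair.1 hr
    exact ⟨p.fst, q.fst, ⟨p, hp, hr.1.at⟩, ⟨q, hq, hr.2.at⟩, ha⟩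
  · rintro ⟨f, g, ⟨p, hp, hpr, hpf⟩, ⟨q, hq, hqr, hqg⟩, ha⟩
    exact ⟨p, hp, q, hq, Piece.reg_pair.2 ⟨hpr, hqr⟩, (hpf.pair hqg).trans ha⟩

theorem germAt_add {S T : Finset (Piece A B)} {x : Point A} {h : A ⟶ B} :
    GermAt (Finset.image₂ Piece.add S T) x h ↔
      ∃ f g, GermAt S x f ∧ GermAt T x g ∧ x.Agree (AdditiveOp.add f g) h := by
  simp only [GermAt, Finset.exists_mem_image₂]
  constructor
  · rintro ⟨p, hp, q, hq, hr, ha⟩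
    have hr := Piece.reg_add.1 hr
    exact ⟨p.fst, q.fst, ⟨p, hp, hr.1.at⟩, ⟨q, hq, hr.2.at⟩, ha⟩
  · rintro ⟨f, g, ⟨p, hp, hpr, hpf⟩, ⟨q, hq, hqr, hqg⟩, ha⟩
    exact ⟨p, hp, q, hq, Piece.reg_add.2 ⟨hpr, hqr⟩, (hpf.add hqg).trans ha⟩

theorem germAt_diff {S : Finset (Piece A B)} {x : Point (prod A A)} {h : prod A A ⟶ B} :
    GermAt (S.image Piece.D) x h ↔ ∃ f, GermAt S (x.push (π₁ A A)) f ∧ x.Agree (D f) h := by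
  simp only [GermAt, Finset.exists_mem_image]
  constructor
  · rintro ⟨p, hp, hr, ha⟩
    exact ⟨p.fst, ⟨p, hp, (Piece.reg_D.1 hr).at⟩, ha⟩
  · rintro ⟨f, ⟨p, hp, hpr, hpf⟩, ha⟩
    exact ⟨p, hp, Piece.reg_D.2 hpr, hpf.D.trans ha⟩

theorem at_comp {a : ClHom A B} {b : ClHom B E} {x : Point A} {h : A ⟶ E} :
    (a.comp b).At x h ↔ ∃ f g, a.At x f ∧ b.At (x.push f) g ∧ x.Agree (f ≫ g) h := by
  simp only [comp, at_mk, germAt_comp, at_out]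

theorem at_restr {a : ClHom A B} {x : Point A} {h : A ⟶ A} :
    a.restr.At x h ↔ ∃ f, a.At x f ∧ x.Agree (rest f) h := by
  simp only [restr, at_mk, germAt_restr, at_out]

theorem at_pair {a : ClHom Z A} {b : ClHom Z B} {x : Point Z} {h : Z ⟶ prod A B} :
    (a.pair b).At x h ↔ ∃ f g, a.At x f ∧ b.At x g ∧ x.Agree (ProductOp.pair f g) h := by
  simp only [pair, at_mk, germAt_pair, at_out]

theorem at_add {a b : ClHom A B} {x : Point A} {h : A ⟶ B} :
    (a.add b).At x h ↔ ∃ f g, a.At x f ∧ b.At x g ∧ x.Agree (AdditiveOp.add f g) h := by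
  simp only [add, at_mk, germAt_add, at_out]

theorem at_diff {a : ClHom A B} {x : Point (prod A A)} {h : prod A A ⟶ B} :
    a.diff.At x h ↔ ∃ f, a.At (x.push (π₁ A A)) f ∧ x.Agree (D f) h := by
  simp only [diff, at_mk, germAt_diff, at_out]

theorem at_ofMap {m f : A ⟶ B} {x : Point A} : (ofMap m).At x f ↔ x.Has m ∧ x.Agree m f := by
  have h : (Piece.ofMap m).Reg x ↔ x.Has m :=
    ⟨fun h => h.1, fun h => ⟨h, Point.not_has_empty⟩⟩
  simp only [ofMap, at_mk, GermAt, Finset.mem_singleton, exists_eq_left, Piece.At, h]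
  rfl

theorem isClassOf {c : ClHom A B} {S : Finset (Piece A B)} (hS : PairwiseDisj S)
    (h : ∀ x f, c.At x f ↔ GermAt S x f) : c.IsClassOf S :=
  ⟨⟨S, hS⟩, rfl, ext_germ fun x f => (h x f).symm⟩

/-- The composite was defined through chosen representatives. The formula applied to `F` and `G` has
the same germs, hence the same class. -/
theorem comp_mk (F : Raw A B) (G : Raw B E) :
    ((mk F).comp (mk G)).IsClassOf (Finset.image₂ Piece.comp F.pieces G.pieces) :=
  isClassOf (PairwiseDisj.image₂ F.disjoint G.disjoint id (fun p x => x.push p.fst)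
    fun _ _ _ => Piece.reg_comp.1) fun x f => by
      rw [at_comp, germAt_comp]; rfl

theorem restr_mk (F : Raw A B) : (mk F).restr.IsClassOf (F.pieces.image Piece.restr) :=
  isClassOf (PairwiseDisj.image F.disjoint id fun _ _ => Piece.reg_restr.1) fun x f => by
    rw [at_restr, germAt_restr]; rfl

theorem pair_mk (F : Raw Z A) (G : Raw Z B) :
    ((mk F).pair (mk G)).IsClassOf (Finset.image₂ Piece.pair F.pieces G.pieces) :=
  isClassOf (PairwiseDisj.image₂ F.disjoint G.disjoint id (fun _ => id)
    fun _ _ _ => Piece.reg_pair.1) fun x f => by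
      rw [at_pair, germAt_pair]; rfl

theorem add_mk (F G : Raw A B) :
    ((mk F).add (mk G)).IsClassOf (Finset.image₂ Piece.add F.pieces G.pieces) :=
  isClassOf (PairwiseDisj.image₂ F.disjoint G.disjoint id (fun _ => id)
    fun _ _ _ => Piece.reg_add.1) fun x f => by
      rw [at_add, germAt_add]; rfl

theorem diff_mk (F : Raw A B) : (mk F).diff.IsClassOf (F.pieces.image Piece.D) :=
  isClassOf (PairwiseDisj.image F.disjoint (fun x => x.push (π₁ A A)) fun _ _ => Piece.reg_D.1)
    fun x f => by rw [at_diff, germAt_diff]; rfl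

/-! ### Germs and domains of the operations -/

section

variable {x : Point Z}

theorem At.comp {a : ClHom Z A} {b : ClHom A B} {f : Z ⟶ A} {g : A ⟶ B} (ha : a.At x f)
    (hb : b.At (x.push f) g) : (a.comp b).At x (f ≫ g) :=
  at_comp.2 ⟨f, g, ha, hb, ha.has.agree_refl⟩

theorem def_comp {a : ClHom Z A} {b : ClHom A B} :
    (a.comp b).Def x ↔ ∃ f, a.At x f ∧ b.Def (x.push f) := by
  constructor
  · rintro ⟨h, hh⟩
    obtain ⟨f, g, hf, hg, -⟩ := at_comp.1 hh
    exact ⟨f, hf, g, hg⟩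
  · rintro ⟨f, hf, g, hg⟩
    exact (hf.comp hg).def

theorem Def.of_comp {a : ClHom Z A} {b : ClHom A B} (h : (a.comp b).Def x) : a.Def x := by
  obtain ⟨f, hf, -⟩ := def_comp.1 h
  exact ⟨f, hf⟩

theorem At.def_comp_iff {a : ClHom Z A} {b : ClHom A B} {f : Z ⟶ A} (ha : a.At x f) :
    (a.comp b).Def x ↔ b.Def (x.push f) := by
  rw [def_comp]
  constructor
  · rintro ⟨f', hf', h⟩
    rwa [(ha.agree hf').push_eq]
  · exact fun h => ⟨f, ha, h⟩

theorem def_restr {a : ClHom Z A} : a.restr.Def x ↔ a.Def x := by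
  constructor
  · rintro ⟨h, hh⟩
    obtain ⟨f, hf, -⟩ := at_restr.1 hh
    exact ⟨f, hf⟩
  · rintro ⟨f, hf⟩
    exact ⟨_, at_restr.2 ⟨f, hf, hf.has.agree_refl⟩⟩

theorem At.restr {a : ClHom Z A} {f : Z ⟶ A} (ha : a.At x f) : a.restr.At x (rest f) :=
  at_restr.2 ⟨f, ha, ha.has.agree_refl⟩

theorem Def.restr {a : ClHom Z A} (ha : a.Def x) : a.restr.At x (𝟙 Z) := by
  obtain ⟨f, hf⟩ := ha
  exact at_restr.2 ⟨f, hf, hf.has.agree_rest_id⟩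

theorem Def.restr_comp {a : ClHom Z A} {b : ClHom Z B} {g : Z ⟶ B} (ha : a.Def x)
    (hb : b.At x g) : (a.restr.comp b).At x g := by
  have := ha.restr.comp (b := b) (g := g) (by rwa [Point.push_id])
  rwa [Category.id_comp] at this

theorem def_restr_comp {a : ClHom Z A} {b : ClHom Z B} :
    (a.restr.comp b).Def x ↔ a.Def x ∧ b.Def x := by
  constructor
  · intro h
    have ha := def_restr.1 h.of_comp
    rw [ha.restr.def_comp_iff, Point.push_id] at h
    exact ⟨ha, h⟩
  · rintro ⟨ha, g, hg⟩
    exact (ha.restr_comp hg).def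

theorem At.pair {a : ClHom Z A} {b : ClHom Z B} {f : Z ⟶ A} {g : Z ⟶ B} (ha : a.At x f)
    (hb : b.At x g) : (a.pair b).At x (ProductOp.pair f g) :=
  at_pair.2 ⟨f, g, ha, hb, ha.has.agree_refl⟩

theorem def_pair {a : ClHom Z A} {b : ClHom Z B} : (a.pair b).Def x ↔ a.Def x ∧ b.Def x := by
  constructor
  · rintro ⟨h, hh⟩
    obtain ⟨f, g, hf, hg, -⟩ := at_pair.1 hh
    exact ⟨⟨f, hf⟩, g, hg⟩
  · rintro ⟨⟨f, hf⟩, g, hg⟩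
    exact (hf.pair hg).def

theorem At.add {a b : ClHom Z A} {f g : Z ⟶ A} (ha : a.At x f) (hb : b.At x g) :
    (a.add b).At x (AdditiveOp.add f g) :=
  at_add.2 ⟨f, g, ha, hb, ha.has.agree_refl⟩

theorem def_add {a b : ClHom Z A} : (a.add b).Def x ↔ a.Def x ∧ b.Def x := by
  constructor
  · rintro ⟨h, hh⟩
    obtain ⟨f, g, hf, hg, -⟩ := at_add.1 hh
    exact ⟨⟨f, hf⟩, g, hg⟩
  · rintro ⟨⟨f, hf⟩, g, hg⟩
    exact (hf.add hg).def

theorem At.diff {a : ClHom A B} {f : A ⟶ B} {x : Point (prod A A)}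
    (ha : a.At (x.push (π₁ A A)) f) : a.diff.At x (D f) :=
  at_diff.2 ⟨f, ha, Point.Has.left (Point.has_push.1 ha.has) |>.agree_refl⟩

theorem def_diff {a : ClHom A B} {x : Point (prod A A)} :
    a.diff.Def x ↔ a.Def (x.push (π₁ A A)) := by
  constructor
  · rintro ⟨h, hh⟩
    obtain ⟨f, hf, -⟩ := at_diff.1 hh
    exact ⟨f, hf⟩
  · rintro ⟨f, hf⟩
    exact hf.diff.def

theorem at_ofMap_self {m : Z ⟶ A} (h : x.Has m) : (ofMap m).At x m :=
  at_ofMap.2 ⟨h, h.agree_refl⟩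

theorem def_ofMap {m : Z ⟶ A} : (ofMap m).Def x ↔ x.Has m :=
  ⟨fun ⟨_, h⟩ => (at_ofMap.1 h).1, fun h => (at_ofMap_self h).def⟩

theorem Def.has_of_push {b : ClHom A B} {f : Z ⟶ A} (h : b.Def (x.push f)) : x.Has f := by
  obtain ⟨g, hg⟩ := h
  exact (Point.has_push.1 hg.has).left

theorem At.ofMap_comp {m : Z ⟶ A} {b : ClHom A B} {g : A ⟶ B} (h : b.At (x.push m) g) :
    ((ofMap m).comp b).At x (m ≫ g) :=
  (at_ofMap_self h.def.has_of_push).comp h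

theorem def_ofMap_comp {m : Z ⟶ A} {b : ClHom A B} :
    ((ofMap m).comp b).Def x ↔ b.Def (x.push m) := by
  constructor
  · intro h
    exact (at_ofMap_self (def_ofMap.1 h.of_comp)).def_comp_iff.1 h
  · rintro ⟨g, hg⟩
    exact hg.ofMap_comp.def

theorem At.comp_ofMap {a : ClHom Z A} {f : Z ⟶ A} (ha : a.At x f) {m : A ⟶ B}
    (h : x.Has (f ≫ m)) : (a.comp (ofMap m)).At x (f ≫ m) :=
  ha.comp (at_ofMap_self (Point.has_push.2 h))

theorem At.comp_total {a : ClHom Z A} {f : Z ⟶ A} (ha : a.At x f) {m : A ⟶ B}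
    (hm : Total m) : (a.comp (ofMap m)).At x (f ≫ m) := by
  refine ha.comp_ofMap ?_
  unfold Point.Has
  rw [← rest_comp_rest, hm, Category.comp_id]
  exact ha.has

theorem def_comp_total {a : ClHom Z A} {m : A ⟶ B} (hm : Total m) :
    (a.comp (ofMap m)).Def x ↔ a.Def x :=
  ⟨Def.of_comp, fun ⟨_, hf⟩ => (hf.comp_total hm).def⟩

end

/-! ### The maps `(f, ∅)` -/

section OfMap

theorem comp_ofMap_ofMap (f : A ⟶ B) (g : B ⟶ E) :
    (ofMap f).comp (ofMap g) = ofMap (f ≫ g) := by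
  refine ext_def fun x h => ?_
  rw [def_ofMap_comp, def_ofMap, def_ofMap, Point.has_push, or_self] at h
  exact ⟨_, _, (at_ofMap_self (Point.has_push.2 h)).ofMap_comp, at_ofMap_self h, h.agree_refl⟩

theorem restr_ofMap (f : A ⟶ B) : (ofMap f).restr = ofMap (rest f) := by
  refine ext_def fun x h => ?_
  rw [def_restr, def_ofMap, def_ofMap, Point.has_rest, or_self] at h
  exact ⟨_, _, (at_ofMap_self h).restr, at_ofMap_self (Point.has_rest.2 h), h.agree_refl⟩

theorem pair_ofMap (f : Z ⟶ A) (g : Z ⟶ B) :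
    (ofMap f).pair (ofMap g) = ofMap (ProductOp.pair f g) := by
  refine ext_def fun x h => ?_
  rw [def_pair, def_ofMap, def_ofMap, def_ofMap, Point.has_pair, or_self] at h
  exact ⟨_, _, (at_ofMap_self h.1).pair (at_ofMap_self h.2), at_ofMap_self (Point.has_pair.2 h),
    h.1.agree_refl⟩

theorem diff_ofMap (f : A ⟶ B) : (ofMap f).diff = ofMap (D f) := by
  refine ext_def fun x h => ?_
  rw [def_diff, def_ofMap, def_ofMap, Point.has_D, Point.has_push, or_self] at h
  exact ⟨_, _, (at_ofMap_self (Point.has_push.2 h)).diff, at_ofMap_self (Point.has_D.2 h),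
    h.agree_refl⟩

end OfMap

end ClHom

end Operations

namespace ClHom

variable {X : Type u} [Category.{v} X] [RestrictionOp X] [ProductOp X] [AdditiveOp X]
  [DifferentialOp X] [DifferentialJoinRestrictionCategory X] {Z A B E F : X}

/-! ### Category and restriction laws -/

theorem id_comp (a : ClHom A B) : (ofMap (𝟙 A)).comp a = a := by
  refine ext_def fun x h => ?_
  rw [def_ofMap_comp, Point.push_id, or_self] at h
  obtain ⟨f, hf⟩ := h
  have h₁ : a.At (x.push (𝟙 A)) f := by rwa [Point.push_id]
  exact ⟨_, f, h₁.ofMap_comp, hf, by rw [Category.id_comp]; exact hf.has.agree_refl⟩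

theorem comp_id (a : ClHom A B) : a.comp (ofMap (𝟙 B)) = a := by
  refine ext_def fun x h => ?_
  rw [def_comp_total (rest_id B), or_self] at h
  obtain ⟨f, hf⟩ := h
  exact ⟨_, f, hf.comp_total (rest_id B), hf, by rw [Category.comp_id]; exact hf.has.agree_refl⟩

theorem assoc (a : ClHom A B) (b : ClHom B E) (c : ClHom E F) :
    (a.comp b).comp c = a.comp (b.comp c) := by
  refine ext_def fun x h => ?_
  obtain ⟨f, hf⟩ : a.Def x := h.elim (fun h => h.of_comp.of_comp) fun h => h.of_comp
  obtain ⟨g, hg⟩ : b.Def (x.push f) :=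
    h.elim (fun h => hf.def_comp_iff.1 h.of_comp) fun h => (hf.def_comp_iff.1 h).of_comp
  obtain ⟨k, hk⟩ : c.Def (x.push (f ≫ g)) := by
    rcases h with h | h
    · exact (hf.comp hg).def_comp_iff.1 h
    · rw [← Point.push_push]
      exact hg.def_comp_iff.1 (hf.def_comp_iff.1 h)
  have hk' := hk
  rw [← Point.push_push] at hk'
  exact ⟨_, _, (hf.comp hg).comp hk, hf.comp (hg.comp hk'), by
    rw [Category.assoc]; exact hf.has.agree_refl⟩

theorem restr_comp_self (a : ClHom A B) : a.restr.comp a = a := by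
  refine ext_def fun x h => ?_
  rw [def_restr_comp, and_self, or_self] at h
  obtain ⟨f, hf⟩ := h
  exact ⟨f, f, hf.def.restr_comp hf, hf, hf.has.agree_refl⟩

theorem restr_comp_restr (a : ClHom A B) (b : ClHom A E) :
    b.restr.comp a.restr = a.restr.comp b.restr := by
  refine ext_def fun x h => ?_
  rw [def_restr_comp, def_restr_comp, def_restr, def_restr, and_comm, or_self] at h
  exact ⟨_, _, h.2.restr_comp h.1.restr, h.1.restr_comp h.2.restr, h.1.mem_id.agree_refl⟩

theorem restr_restr_comp (a : ClHom A B) (b : ClHom A E) :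
    (b.restr.comp a).restr = b.restr.comp a.restr := by
  refine ext_def fun x h => ?_
  rw [def_restr, def_restr_comp, def_restr_comp, def_restr, or_self] at h
  exact ⟨_, _, (def_restr_comp.2 h).restr, h.1.restr_comp h.2.restr, h.1.mem_id.agree_refl⟩

theorem comp_restr (a : ClHom A B) (b : ClHom B E) :
    a.comp b.restr = (a.comp b).restr.comp a := by
  refine ext_def fun x h => ?_
  obtain ⟨f, hf⟩ : a.Def x := h.elim (fun h => h.of_comp) fun h => (def_restr_comp.1 h).2
  have hb : b.Def (x.push f) := h.elim (fun h => def_restr.1 (hf.def_comp_iff.1 h))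
    fun h => hf.def_comp_iff.1 (def_restr_comp.1 h).1
  exact ⟨_, f, hf.comp hb.restr, (hf.def_comp_iff.2 hb).restr_comp hf, by
    rw [Category.comp_id]; exact hf.has.agree_refl⟩

/-- The restriction order of $\mathbf{Cl}(\mathbb X)$ is inclusion of germs, so joins can be sought
as unions. -/
theorem restr_comp_eq_iff {a b : ClHom A B} :
    a.restr.comp b = a ↔ ∀ x f, a.At x f → b.At x f := by
  constructor
  · intro h x f hf
    have hf' := hf
    rw [← h] at hf'
    obtain ⟨g, hg⟩ := (def_restr_comp.1 hf'.def).2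
    have := hf.def.restr_comp hg
    rw [h] at this
    exact hg.congr (this.agree hf)
  · intro h
    refine ext_def fun x hx => ?_
    obtain ⟨f, hf⟩ : a.Def x := hx.elim (fun h => (def_restr_comp.1 h).1) _root_.id
    exact ⟨f, f, hf.def.restr_comp (h x f hf), hf, hf.has.agree_refl⟩

theorem restr_comp_comm_iff {a b : ClHom A B} :
    a.restr.comp b = b.restr.comp a ↔ ∀ x f g, a.At x f → b.At x g → x.Agree f g := by
  constructor
  · intro h x f g hf hg
    have h₁ := hf.def.restr_comp hg
    rw [h] at h₁
    exact (hg.def.restr_comp hf).agree h₁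
  · intro h
    refine ext_def fun x hx => ?_
    rw [def_restr_comp, def_restr_comp, and_comm, or_self] at hx
    obtain ⟨⟨g, hg⟩, f, hf⟩ := hx
    exact ⟨_, _, hf.def.restr_comp hg, hg.def.restr_comp hf, (h x f g hf hg).symm⟩

/-- The condition `x.Has (𝟙 A)` excludes the empty filter, at which no classical map is defined. -/
theorem restr_eq_id_iff {a : ClHom A B} :
    a.restr = ofMap (𝟙 A) ↔ ∀ x : Point A, x.Has (𝟙 A) → a.Def x := by
  constructor
  · intro h x hx
    rw [← def_restr, h, def_ofMap]
    exact hx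
  · intro h
    refine ext_def fun x hx => ?_
    rw [def_restr, def_ofMap] at hx
    have hx' : x.Has (𝟙 A) := hx.elim Def.mem_id _root_.id
    exact ⟨_, _, (h x hx').restr, at_ofMap_self hx', hx'.agree_refl⟩

theorem restr_ofMap_total {m : A ⟶ B} (hm : Total m) : (ofMap m).restr = ofMap (𝟙 A) := by
  rw [restr_ofMap, hm]

/-! ### Cartesian laws -/

theorem eq_bang {a : ClHom A T} (ha : a.restr = ofMap (𝟙 A)) : a = ofMap (bang A) := by
  rw [restr_eq_id_iff] at ha
  refine ext_def fun x h => ?_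
  have hx : x.Has (𝟙 A) := h.elim Def.mem_id Def.mem_id
  obtain ⟨f, hf⟩ := ha x hx
  refine ⟨f, _, hf, at_ofMap_self hx.bang, ?_⟩
  have h := hf.has.agree_comp_bang
  rwa [CartesianRestrictionCategory.bang_T, Category.comp_id] at h

theorem comp_bang_le (a : ClHom A B) :
    (a.comp (ofMap (bang B))).restr.comp (ofMap (bang A)) = a.comp (ofMap (bang B)) := by
  have ht := CartesianRestrictionCategory.bang_total B
  refine ext_def fun x h => ?_
  obtain ⟨f, hf⟩ : a.Def x := h.elim (fun h => (def_restr_comp.1 h).1.of_comp) fun h => h.of_comp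
  exact ⟨_, _, ((def_comp_total ht).2 hf.def).restr_comp (at_ofMap_self hf.has.bang),
    hf.comp_total ht, hf.has.agree_comp_bang.symm⟩

theorem pair_comp_π₀ (a : ClHom Z A) (b : ClHom Z B) :
    (a.pair b).comp (ofMap (π₀ A B)) = (a.pair b).restr.comp a := by
  have ht := CartesianRestrictionCategory.π₀_total A B
  refine ext_def fun x h => ?_
  rw [def_comp_total ht, def_restr_comp, def_pair] at h
  obtain ⟨⟨f, hf⟩, g, hg⟩ : a.Def x ∧ b.Def x := by tauto
  exact ⟨_, _, (hf.pair hg).comp_total ht, (hf.pair hg).def.restr_comp hf, hg.has.agree_pair_π₀⟩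

theorem pair_comp_π₁ (a : ClHom Z A) (b : ClHom Z B) :
    (a.pair b).comp (ofMap (π₁ A B)) = (a.pair b).restr.comp b := by
  have ht := CartesianRestrictionCategory.π₁_total A B
  refine ext_def fun x h => ?_
  rw [def_comp_total ht, def_restr_comp, def_pair] at h
  obtain ⟨⟨f, hf⟩, g, hg⟩ : a.Def x ∧ b.Def x := by tauto
  exact ⟨_, _, (hf.pair hg).comp_total ht, (hf.pair hg).def.restr_comp hg, hf.has.agree_pair_π₁⟩

theorem restr_pair (a : ClHom Z A) (b : ClHom Z B) :
    (a.pair b).restr = a.restr.comp b.restr := by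
  refine ext_def fun x h => ?_
  rw [def_restr, def_restr_comp, def_pair, def_restr, or_self] at h
  exact ⟨_, _, (def_pair.2 h).restr, h.1.restr_comp h.2.restr, h.1.mem_id.agree_refl⟩

theorem eq_pair {a : ClHom Z A} {b : ClHom Z B} {c : ClHom Z (prod A B)}
    (h₀ : c.comp (ofMap (π₀ A B)) = c.restr.comp a)
    (h₁ : c.comp (ofMap (π₁ A B)) = c.restr.comp b)
    (hr : c.restr = a.restr.comp b.restr) : c = a.pair b := by
  have hdef : ∀ x, c.Def x ↔ a.Def x ∧ b.Def x := fun x => by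
    rw [← def_restr, hr, def_restr_comp, def_restr]
  refine ext_def fun x h => ?_
  rw [def_pair, ← hdef, or_self] at h
  obtain ⟨⟨f, hf⟩, g, hg⟩ := (hdef x).1 h
  obtain ⟨k, hk⟩ := h
  refine ⟨k, _, hk, hf.pair hg, ?_⟩
  have e₀ := hk.comp_total (CartesianRestrictionCategory.π₀_total A B)
  have e₁ := hk.comp_total (CartesianRestrictionCategory.π₁_total A B)
  rw [h₀] at e₀
  rw [h₁] at e₁
  -- The germ `k` is recovered as the pairing of its projections, which agree with the germs of `a`
  -- and `b`.
  rw [DiffRestr.eq_pair k]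
  exact (e₀.agree (hk.def.restr_comp hf)).pair (e₁.agree (hk.def.restr_comp hg))

/-! ### Additive laws -/

theorem add_assoc (a b c : ClHom A B) : (a.add b).add c = a.add (b.add c) := by
  refine ext_def fun x h => ?_
  simp only [def_add] at h
  obtain ⟨⟨f, hf⟩, ⟨g, hg⟩, k, hk⟩ : a.Def x ∧ b.Def x ∧ c.Def x := by tauto
  exact ⟨_, _, (hf.add hg).add hk, hf.add (hg.add hk), by
    rw [LeftAdditiveRestrictionCategory.add_assoc]; exact hf.has.agree_refl⟩

theorem add_comm (a b : ClHom A B) : a.add b = b.add a := by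
  refine ext_def fun x h => ?_
  simp only [def_add] at h
  obtain ⟨⟨f, hf⟩, g, hg⟩ : a.Def x ∧ b.Def x := by tauto
  exact ⟨_, _, hf.add hg, hg.add hf, by
    rw [LeftAdditiveRestrictionCategory.add_comm]; exact hf.has.agree_refl⟩

theorem zero_add (a : ClHom A B) : (ofMap (zero A B)).add a = a := by
  refine ext_def fun x h => ?_
  simp only [def_add] at h
  obtain ⟨f, hf⟩ : a.Def x := by tauto
  exact ⟨_, _, (at_ofMap_self hf.has.zero).add hf, hf, by
    rw [LeftAdditiveRestrictionCategory.zero_add]; exact hf.has.agree_refl⟩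

theorem restr_add (a b : ClHom A B) : (a.add b).restr = a.restr.comp b.restr := by
  refine ext_def fun x h => ?_
  rw [def_restr, def_restr_comp, def_add, def_restr, or_self] at h
  exact ⟨_, _, (def_add.2 h).restr, h.1.restr_comp h.2.restr, h.1.mem_id.agree_refl⟩

theorem comp_add (a : ClHom Z A) (b c : ClHom A B) :
    a.comp (b.add c) = (a.comp b).add (a.comp c) := by
  refine ext_def fun x h => ?_
  obtain ⟨f, hf⟩ : a.Def x := h.elim (fun h => h.of_comp) fun h => (def_add.1 h).1.of_comp
  simp only [def_add, hf.def_comp_iff, or_self] at h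
  obtain ⟨⟨g, hg⟩, k, hk⟩ := h
  exact ⟨_, _, hf.comp (hg.add hk), (hf.comp hg).add (hf.comp hk), by
    rw [LeftAdditiveRestrictionCategory.comp_add]; exact hf.has.agree_refl⟩

theorem comp_zero (a : ClHom Z A) (B : X) :
    a.comp (ofMap (zero A B)) = a.restr.comp (ofMap (zero Z B)) := by
  have ht : Total (zero A B) := LeftAdditiveRestrictionCategory.rest_zero A B
  refine ext_def fun x h => ?_
  rw [def_comp_total ht, def_restr_comp] at h
  obtain ⟨f, hf⟩ : a.Def x := by tauto
  exact ⟨_, _, hf.comp_total ht, hf.def.restr_comp (at_ofMap_self hf.has.zero),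
    hf.has.agree_comp_zero⟩

theorem pair_comp_add (a b : ClHom A E) (c d : ClHom B F) :
    ((ofMap (π₀ A B)).comp (a.add b)).pair ((ofMap (π₁ A B)).comp (c.add d)) =
      (((ofMap (π₀ A B)).comp a).pair ((ofMap (π₁ A B)).comp c)).add
        (((ofMap (π₀ A B)).comp b).pair ((ofMap (π₁ A B)).comp d)) := by
  refine ext_def fun x h => ?_
  simp only [def_pair, def_add, def_ofMap_comp] at h
  obtain ⟨⟨f, hf⟩, ⟨g, hg⟩, ⟨k, hk⟩, l, hl⟩ : a.Def (x.push (π₀ A B)) ∧ b.Def (x.push (π₀ A B)) ∧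
    c.Def (x.push (π₁ A B)) ∧ d.Def (x.push (π₁ A B)) := by tauto
  refine ⟨_, _, (hf.add hg).ofMap_comp.pair (hk.add hl).ofMap_comp,
    (hf.ofMap_comp.pair hk.ofMap_comp).add (hg.ofMap_comp.pair hl.ofMap_comp), ?_⟩
  have := CartesianLeftAdditiveRestrictionCategory.prodMap_add f g k l
  unfold prodMap at this
  rw [this]
  exact hf.def.has_of_push.agree_refl

/-- Compatibility in $\mathbf{Cl}(\mathbb X)$ only concerns points where both sides are defined.
There it follows from compatibility of $(f+g)m$ and $fm+gm$ for representing germs $f,g$. -/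
theorem additive_add {m : A ⟶ B} (hm : IsAdditive m) (a b : ClHom Z A) :
    ((a.add b).comp (ofMap m)).restr.comp ((a.comp (ofMap m)).add (b.comp (ofMap m))) =
      ((a.comp (ofMap m)).add (b.comp (ofMap m))).restr.comp ((a.add b).comp (ofMap m)) := by
  rw [restr_comp_comm_iff]
  intro x k l hk hl
  obtain ⟨⟨f, hf⟩, g, hg⟩ := def_add.1 hk.def.of_comp
  have hfm := (hf.add hg).comp_ofMap (m := m) <| Point.has_push.1 <| def_ofMap.1 <|
    (hf.add hg).def_comp_iff.1 hk.def
  obtain ⟨h₁, h₂⟩ := def_add.1 hl.def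
  have hfm' := (hf.comp_ofMap (Point.has_push.1 (def_ofMap.1 (hf.def_comp_iff.1 h₁)))).add
    (hg.comp_ofMap (Point.has_push.1 (def_ofMap.1 (hg.def_comp_iff.1 h₂))))
  exact (hk.agree hfm).trans ((Point.agree_of_compat (hm.1 Z f g) hfm.has hfm'.has).trans
    (hfm'.agree hl))

theorem additive_zero {m : A ⟶ B} (hm : IsAdditive m) (Z : X) :
    ((ofMap (zero Z A)).comp (ofMap m)).restr.comp (ofMap (zero Z B)) =
      (ofMap (zero Z B)).restr.comp ((ofMap (zero Z A)).comp (ofMap m)) := by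
  rw [restr_ofMap, comp_ofMap_ofMap, restr_ofMap, comp_ofMap_ofMap, comp_ofMap_ofMap]
  exact congrArg ofMap (hm.2 Z)

/-! ### Differential laws -/

/-- Pushing a point along $\langle f,g\rangle$ and then $\pi_1$ is pushing it along $g$, provided
$f$ is defined there. -/
theorem At.diff_push_pair {x : Point Z} {a : ClHom A B} {f g : Z ⟶ A} {n : A ⟶ B} (hf : x.Has f)
    (h : a.At (x.push g) n) : a.diff.At (x.push (ProductOp.pair f g)) (D n) := by
  refine At.diff ?_
  rwa [Point.push_push, (hf.agree_pair_π₁ (g := g)).push_eq]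

theorem def_diff_push_pair {x : Point Z} {a : ClHom A B} {f g : Z ⟶ A} (hf : x.Has f) :
    a.diff.Def (x.push (ProductOp.pair f g)) ↔ a.Def (x.push g) := by
  rw [def_diff, Point.push_push, (hf.agree_pair_π₁ (g := g)).push_eq]

theorem def_pair_comp_diff {x : Point Z} {a b : ClHom Z A} {c : ClHom A B} :
    ((a.pair b).comp c.diff).Def x ↔ a.Def x ∧ (b.comp c).Def x := by
  constructor
  · intro h
    obtain ⟨⟨f, hf⟩, g, hg⟩ := def_pair.1 h.of_comp
    rw [(hf.pair hg).def_comp_iff, def_diff_push_pair hf.has] at h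
    exact ⟨hf.def, hg.def_comp_iff.2 h⟩
  · rintro ⟨⟨f, hf⟩, h⟩
    obtain ⟨g, hg⟩ := h.of_comp
    rw [(hf.pair hg).def_comp_iff, def_diff_push_pair hf.has]
    exact hg.def_comp_iff.1 h

theorem At.pair_comp_diff {x : Point Z} {a b : ClHom Z A} {c : ClHom A B} {f g : Z ⟶ A}
    {n : A ⟶ B} (ha : a.At x f) (hb : b.At x g) (hc : c.At (x.push g) n) :
    ((a.pair b).comp c.diff).At x (ProductOp.pair f g ≫ D n) :=
  (ha.pair hb).comp (hc.diff_push_pair ha.has)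

theorem diff_add (a b : ClHom A B) : (a.add b).diff = a.diff.add b.diff := by
  refine ext_def fun x h => ?_
  simp only [def_add, def_diff, or_self] at h
  obtain ⟨⟨f, hf⟩, g, hg⟩ := h
  exact ⟨_, _, (hf.add hg).diff, hf.diff.add hg.diff, by
    rw [DifferentialRestrictionCategory.DR1_add]; exact hf.def.has_of_push.agree_refl⟩

theorem add_pair_comp_diff (a : ClHom A B) (b c d : ClHom Z A) :
    ((b.add c).pair d).comp a.diff = ((b.pair d).comp a.diff).add ((c.pair d).comp a.diff) := by
  refine ext_def fun x h => ?_
  simp only [def_add, def_pair_comp_diff] at h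
  obtain ⟨⟨g, hg⟩, ⟨k, hk⟩, hl'⟩ : b.Def x ∧ c.Def x ∧ (d.comp a).Def x := by tauto
  obtain ⟨l, hl, n, hn⟩ := def_comp.1 hl'
  exact ⟨_, _, (hg.add hk).pair_comp_diff hl hn,
    (hg.pair_comp_diff hl hn).add (hk.pair_comp_diff hl hn), by
    rw [DifferentialRestrictionCategory.DR2_add]; exact hg.has.agree_refl⟩

theorem zero_pair_comp_diff (a : ClHom A B) (b : ClHom Z A) :
    ((ofMap (zero Z A)).pair b).comp a.diff = (b.comp a).restr.comp (ofMap (zero Z B)) := by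
  refine ext_def fun x h => ?_
  simp only [def_pair_comp_diff, def_restr_comp] at h
  have h' : (b.comp a).Def x := by tauto
  obtain ⟨g, hg, n, hn⟩ := def_comp.1 h'
  refine ⟨_, _, (at_ofMap_self hg.has.zero).pair_comp_diff hg hn,
    h'.restr_comp (at_ofMap_self hg.has.zero), ?_⟩
  rw [DifferentialRestrictionCategory.DR2_zero]
  exact (hg.comp hn).has.agree_rest_comp _

theorem diff_pair (a : ClHom Z A) (b : ClHom Z B) : (a.pair b).diff = a.diff.pair b.diff := by
  refine ext_def fun x h => ?_
  simp only [def_pair, def_diff, or_self] at h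
  obtain ⟨⟨f, hf⟩, g, hg⟩ := h
  exact ⟨_, _, (hf.pair hg).diff, hf.diff.pair hg.diff, by
    rw [DifferentialRestrictionCategory.DR4]; exact hf.def.has_of_push.agree_refl⟩

theorem diff_comp (a : ClHom A B) (b : ClHom B E) :
    (a.comp b).diff = (a.diff.pair ((ofMap (π₁ A A)).comp a)).comp b.diff := by
  refine ext_def fun x h => ?_
  rw [def_diff, def_pair_comp_diff, assoc, def_ofMap_comp] at h
  have h' : (a.comp b).Def (x.push (π₁ A A)) := by tauto
  obtain ⟨f, hf, g, hg⟩ := def_comp.1 h'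
  have hg' := hg
  rw [Point.push_push] at hg'
  exact ⟨_, _, (hf.comp hg).diff, hf.diff.pair_comp_diff hf.ofMap_comp hg', by
    rw [DifferentialRestrictionCategory.DR5]; exact hf.def.has_of_push.agree_refl⟩

theorem pair_zero_comp_diff_diff (a : ClHom A B) (b c d : ClHom Z A) :
    ((b.pair (ofMap (zero Z A))).pair (c.pair d)).comp a.diff.diff =
      c.restr.comp ((b.pair d).comp a.diff) := by
  refine ext_def fun x h => ?_
  simp only [def_restr_comp, def_pair, def_pair_comp_diff] at h
  obtain ⟨⟨g, hg⟩, ⟨k, hk⟩, hl'⟩ : b.Def x ∧ c.Def x ∧ (d.comp a).Def x := by tauto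
  obtain ⟨l, hl, n, hn⟩ := def_comp.1 hl'
  refine ⟨_, _, (hg.pair (at_ofMap_self hg.has.zero)).pair_comp_diff (hk.pair hl)
    (hn.diff_push_pair hk.has), hk.def.restr_comp (hg.pair_comp_diff hl hn), ?_⟩
  rw [DifferentialRestrictionCategory.DR6]
  exact hk.has.agree_rest_comp _

theorem zero_pair_comp_diff_diff (a : ClHom A B) (b c d : ClHom Z A) :
    (((ofMap (zero Z A)).pair c).pair (b.pair d)).comp a.diff.diff =
      (((ofMap (zero Z A)).pair b).pair (c.pair d)).comp a.diff.diff := by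
  refine ext_def fun x h => ?_
  simp only [def_pair, def_pair_comp_diff] at h
  obtain ⟨⟨g, hg⟩, ⟨k, hk⟩, hl'⟩ : b.Def x ∧ c.Def x ∧ (d.comp a).Def x := by tauto
  obtain ⟨l, hl, n, hn⟩ := def_comp.1 hl'
  refine ⟨_, _, ((at_ofMap_self hg.has.zero).pair hk).pair_comp_diff (hg.pair hl)
    (hn.diff_push_pair hg.has), ((at_ofMap_self hg.has.zero).pair hg).pair_comp_diff (hk.pair hl)
    (hn.diff_push_pair hk.has), ?_⟩
  rw [DifferentialRestrictionCategory.DR7]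
  exact hk.has.agree_refl

theorem def_id_prod {x : Point (prod A A)} {c : ClHom A A} :
    (((ofMap (π₀ A A)).comp (ofMap (𝟙 A))).pair ((ofMap (π₁ A A)).comp c)).Def x ↔
      c.Def (x.push (π₁ A A)) := by
  rw [comp_id, def_pair, def_ofMap_comp, def_ofMap]
  exact ⟨fun h => h.2, fun h => ⟨h.has_of_push.π₀, h⟩⟩

theorem At.id_prod {x : Point (prod A A)} {c : ClHom A A} {e : A ⟶ A}
    (h : c.At (x.push (π₁ A A)) e) :
    (((ofMap (π₀ A A)).comp (ofMap (𝟙 A))).pair ((ofMap (π₁ A A)).comp c)).At x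
      (prodMap (𝟙 A) e) := by
  rw [comp_ofMap_ofMap]
  refine (at_ofMap_self ?_).pair h.ofMap_comp
  rw [Category.comp_id]
  exact h.def.has_of_push.π₀

theorem diff_restr (a : ClHom A B) :
    a.restr.diff = (((ofMap (π₀ A A)).comp (ofMap (𝟙 A))).pair
      ((ofMap (π₁ A A)).comp a.restr)).comp (ofMap (π₀ A A)) := by
  have ht := CartesianRestrictionCategory.π₀_total A A
  refine ext_def fun x h => ?_
  rw [def_diff, def_comp_total ht, def_id_prod, def_restr, or_self] at h
  obtain ⟨f, hf⟩ := h
  exact ⟨_, _, hf.restr.diff, hf.restr.id_prod.comp_total ht, by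
    rw [DifferentialRestrictionCategory.DR8]; exact hf.def.has_of_push.agree_refl⟩

theorem restr_diff (a : ClHom A B) :
    a.diff.restr = ((ofMap (π₀ A A)).comp (ofMap (𝟙 A))).pair
      ((ofMap (π₁ A A)).comp a.restr) := by
  refine ext_def fun x h => ?_
  rw [def_restr, def_diff, def_id_prod, def_restr, or_self] at h
  obtain ⟨f, hf⟩ := h
  exact ⟨_, _, hf.diff.restr, hf.restr.id_prod, by
    rw [DifferentialRestrictionCategory.DR9]; exact hf.def.has_of_push.agree_refl⟩

/-! ### Joins -/

-- The complement of $\overline f\setminus\overline{f'}$ is the disjoint union of the outside of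
-- $\overline f$ and the inside of $\overline{f'}$, and both parts are reached by cutting. The
-- pieces of `T` are removed one at a time, so they need not be disjoint.
open Classical in
theorem exists_difference {S : Finset (Piece A B)} (hS : PairwiseDisj S)
    (T : Finset (Piece A B)) :
    ∃ U, PairwiseDisj U ∧ ∀ x f, GermAt U x f ↔ GermAt S x f ∧ ¬ DefinedAt T x := by
  induction T using Finset.induction_on with
  | empty => exact ⟨S, hS, fun x f => by simp [DefinedAt]⟩
  | insert p T _ ih =>
    obtain ⟨U, hU, h⟩ := ih
    have he := rest_rest p.fst
    have he' := rest_rest p.snd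
    have hle : ∀ {x : Point A}, x.mem (rest p.snd) → x.mem (rest p.fst) :=
      fun {x} (h : x.Has p.snd) => h.mono p.le
    refine ⟨_, pairwiseDisj_union (hU.outside he) (hU.inside he') fun x h₁ h₂ =>
      ((definedAt_image_outside he).1 h₁).1 (hle ((definedAt_image_inside he').1 h₂).1), ?_⟩
    intro x f
    have hd : DefinedAt (insert p T) x ↔
        (x.mem (rest p.fst) ∧ ¬ x.mem (rest p.snd)) ∨ DefinedAt T x := by
      simp only [DefinedAt, Finset.mem_insert, exists_eq_or_imp]
      rfl
    have hx := hle (x := x)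
    rw [germAt_union, germAt_image_outside he, germAt_image_inside he', h, hd]
    tauto

-- The join is `a` together with the part of `b` where `a` is undefined. Nothing is lost on the
-- overlap, where the germs agree.
open Classical in
theorem exists_join_pair {a b : ClHom A B} (h : ∀ x f g, a.At x f → b.At x g → x.Agree f g) :
    ∃ c : ClHom A B, ∀ x f, c.At x f ↔ a.At x f ∨ b.At x f := by
  obtain ⟨U, hU, hUb⟩ := exists_difference b.out.disjoint a.out.pieces
  have hdef : ∀ x, DefinedAt a.out.pieces x ↔ a.Def x := fun x => by
    simp only [definedAt_iff, at_out, Def]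
  refine ⟨mk ⟨a.out.pieces ∪ U, pairwiseDisj_union a.out.disjoint hU fun x hx hx' => ?_⟩,
    fun x f => ?_⟩
  · obtain ⟨f, hf⟩ := definedAt_iff.1 hx'
    exact ((hUb x f).1 hf).2 hx
  · rw [at_mk, germAt_union, hUb, at_out, at_out, hdef]
    constructor
    · tauto
    · rintro (hf | hf)
      · exact .inl hf
      · by_cases ha : a.Def x
        · obtain ⟨g, hg⟩ := ha
          exact .inl (hg.congr (h x g f hg hf))
        · exact .inr ⟨hf, ha⟩

/-- A finite set of classical maps whose germs agree has a union. -/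
theorem exists_union {s : Set (ClHom A B)} (hs : s.Finite)
    (h : ∀ a ∈ s, ∀ b ∈ s, ∀ x f g, a.At x f → b.At x g → x.Agree f g) :
    ∃ c : ClHom A B, ∀ x f, c.At x f ↔ ∃ a ∈ s, a.At x f := by
  induction s, hs using Set.Finite.induction_on with
  | empty =>
    refine ⟨ofMap (empty A B), fun x f => ?_⟩
    simp [at_ofMap]
  | @insert a s _ _ ih =>
    obtain ⟨c, hc⟩ := ih fun b hb d hd => h b (.inr hb) d (.inr hd)
    obtain ⟨c', hc'⟩ := exists_join_pair (a := a) (b := c) fun x f g hf hg => by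
      obtain ⟨b, hb, hbg⟩ := (hc x g).1 hg
      exact h a (.inl rfl) b (.inr hb) x f g hf hbg
    refine ⟨c', fun x f => ?_⟩
    rw [hc', hc]
    simp [Set.mem_insert_iff]

end ClHom

/-! ### The differential join restriction category of classical maps -/

section Completion

variable (X : Type u) [Category.{v} X] [RestrictionOp X] [ProductOp X] [AdditiveOp X]
  [DifferentialOp X] [DifferentialJoinRestrictionCategory X]

/-- The operations on classical maps. -/
noncomputable def clOperations : ClOperations X where
  comp := ClHom.comp
  restr := ClHom.restr
  pair := ClHom.pair
  add := ClHom.add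
  diff := ClHom.diff
  comp_mk := ClHom.comp_mk
  restr_mk := ClHom.restr_mk
  pair_mk := ClHom.pair_mk
  add_mk := ClHom.add_mk
  diff_mk := ClHom.diff_mk
  id_comp := ClHom.id_comp
  comp_id := ClHom.comp_id
  assoc := ClHom.assoc

open ClHom in
theorem clOperations_isDifferentialJoinRestrictionCategory :
    (clOperations X).IsDifferentialJoinRestrictionCategory := by
  let := (clOperations X).category
  let := (clOperations X).restrictionOp
  let := (clOperations X).productOp
  let := (clOperations X).additiveOp
  let := (clOperations X).differentialOp
  have le_iff : ∀ {A B : Cl X} {f g : A ⟶ B},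
      Le f g ↔ ∀ x k, ClHom.At f x k → ClHom.At g x k := restr_comp_eq_iff
  have ofMap_additive : ∀ {A B : X} {m : A ⟶ B}, IsAdditive m →
      IsAdditive (C := Cl X) (A := ⟨A⟩) (B := ⟨B⟩) (ofMap m) :=
    fun hm => ⟨fun _ a b => additive_add hm a b, fun Z => additive_zero hm Z.obj⟩
  exact
  { R1 := restr_comp_self
    R2 := restr_comp_restr
    R3 := restr_restr_comp
    R4 := comp_restr
    exists_join := by
      intro A B s hs hcompat
      obtain ⟨j, hj⟩ := exists_union hs fun a ha b hb =>
        restr_comp_comm_iff.1 (hcompat a ha b hb)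
      -- A union of germs is a join, and precomposition distributes over unions of germs, so this
      -- one criterion yields both requirements on `j`.
      have isJoin : ∀ {A B : Cl X} {s : Set (A ⟶ B)} {j : A ⟶ B},
          (∀ x f, ClHom.At j x f ↔ ∃ a ∈ s, ClHom.At a x f) → IsJoin s j := fun hj =>
        ⟨fun a ha => le_iff.2 fun x f hf => (hj x f).2 ⟨a, ha, hf⟩, fun g hg => le_iff.2
          fun x f hf => by
            obtain ⟨a, ha, haf⟩ := (hj x f).1 hf
            exact le_iff.1 (hg a ha) x f haf⟩
      refine ⟨j, isJoin hj, fun {Z} h => isJoin fun x f => ?_⟩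
      rw [Set.exists_mem_image]
      refine at_comp.trans ⟨?_, ?_⟩
      · rintro ⟨k, g, hk, hg, hf⟩
        obtain ⟨a, ha, hag⟩ := (hj _ _).1 hg
        exact ⟨a, ha, at_comp.2 ⟨k, g, hk, hag, hf⟩⟩
      · rintro ⟨a, ha, haf⟩
        obtain ⟨k, g, hk, hg, hf⟩ := at_comp.1 haf
        exact ⟨k, g, hk, (hj _ _).2 ⟨a, ha, hg⟩, hf⟩
    bang_total := fun A => restr_ofMap_total (CartesianRestrictionCategory.bang_total A.obj)
    bang_unique := fun _ hf => eq_bang hf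
    bang_T := congrArg ofMap CartesianRestrictionCategory.bang_T
    comp_bang := comp_bang_le
    π₀_total := fun A B =>
      restr_ofMap_total (CartesianRestrictionCategory.π₀_total A.obj B.obj)
    π₁_total := fun A B =>
      restr_ofMap_total (CartesianRestrictionCategory.π₁_total A.obj B.obj)
    pair_π₀ := pair_comp_π₀
    pair_π₁ := pair_comp_π₁
    rest_pair := restr_pair
    pair_unique := fun _ _ _ h₀ h₁ hr => ClHom.eq_pair h₀ h₁ hr
    add_assoc := ClHom.add_assoc
    add_comm := ClHom.add_comm
    zero_add := ClHom.zero_add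
    rest_add := restr_add
    rest_zero := fun A B =>
      restr_ofMap_total (LeftAdditiveRestrictionCategory.rest_zero A.obj B.obj)
    comp_add := ClHom.comp_add
    comp_zero := fun f B => ClHom.comp_zero f B.obj
    prodMap_add := pair_comp_add
    prodMap_zero := fun A B A' B' => by
      change ofMap _ = ClHom.pair (ClHom.comp (ofMap _) (ofMap _)) (ClHom.comp (ofMap _) (ofMap _))
      rw [comp_ofMap_ofMap, comp_ofMap_ofMap, pair_ofMap]
      exact congrArg ofMap
        (CartesianLeftAdditiveRestrictionCategory.prodMap_zero A.obj B.obj A'.obj B'.obj)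
    π₀_additive := fun A B =>
      ofMap_additive (CartesianLeftAdditiveRestrictionCategory.π₀_additive A.obj B.obj)
    π₁_additive := fun A B =>
      ofMap_additive (CartesianLeftAdditiveRestrictionCategory.π₁_additive A.obj B.obj)
    diag_additive := fun A => by
      have h := ofMap_additive (CartesianLeftAdditiveRestrictionCategory.diag_additive A.obj)
      -- The diagonal of $\mathbf{Cl}(\mathbb X)$ is by definition a pairing of identities
      -- $(1,\emptyset)$; it has to be recognised as the image of the diagonal of $\mathbb X$.
      rw [diag, ← pair_ofMap] at h
      exact h
    DR1_add := diff_add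
    DR1_zero := fun A B => (diff_ofMap _).trans
      (congrArg ofMap (DifferentialRestrictionCategory.DR1_zero A.obj B.obj))
    DR2_add := add_pair_comp_diff
    DR2_zero := zero_pair_comp_diff
    DR3_π₀ := fun A B => (diff_ofMap _).trans
      ((congrArg ofMap (DifferentialRestrictionCategory.DR3_π₀ A.obj B.obj)).trans
        (comp_ofMap_ofMap _ _).symm)
    DR3_π₁ := fun A B => (diff_ofMap _).trans
      ((congrArg ofMap (DifferentialRestrictionCategory.DR3_π₁ A.obj B.obj)).trans
        (comp_ofMap_ofMap _ _).symm)
    DR4 := diff_pair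
    DR5 := diff_comp
    DR6 := pair_zero_comp_diff_diff
    DR7 := zero_pair_comp_diff_diff
    DR8 := diff_restr
    DR9 := restr_diff }

end Completion

end DiffRestr

theorem mainTheorem3 (X : Type u) [CategoryTheory.Category.{v} X]
    [DiffRestr.RestrictionOp X] [DiffRestr.ProductOp X] [DiffRestr.AdditiveOp X]
    [DiffRestr.DifferentialOp X] [DiffRestr.DifferentialJoinRestrictionCategory X] :
    ∃ K : DiffRestr.ClOperations X, K.IsDifferentialJoinRestrictionCategory :=
  ⟨DiffRestr.clOperations X, DiffRestr.clOperations_isDifferentialJoinRestrictionCategory X⟩
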